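/- Fix integers $n\ge 1$, $d\ge 0$, $m\ge 0$. A record is a pair $(x,y)$ with $x\in\mathbb R^d$, $\|x\|_2=1$, $y\in\{-1,1\}$; a database $D$ is an $n$-tuple of records, and two databases are neighbours if they differ in the value of at most one record. A randomized mechanism $\mathcal M$ satisfies $\epsilon$-differential privacy if $\Pr(\mathcal M(D)\in V)\le e^{\epsilon}\Pr(\mathcal M(D')\in V)$ for all neighbours $D,D'$ and all measurable $V$; it satisfies $\rho$-zCDP if $D_a(\mathcal M(D)\|\mathcal M(D'))\le\rho a$ for all neighbours $D,D'$ and all $a\in(1,\infty)$, where $D_a$ is the Rényi divergence of order $a$. The $L_2$-sensitivity of a vector- or matrix-valued function $g$ of the database is $\sup\|g(D)-g(D')\|_2$ over neighbours (for matrices: the Euclidean norm of the vector of entries). For $s\ge0$ and $\phi>0$ let $\nu_k(s,\phi)$ be the following law on $\mathbb R^k$. In the DP variant it has density proportional to $e^{-\gamma\|\beta\|_2}$ with $\gamma=\phi/s$ (and is the point mass at $0$ if $s=0$); in the zCDP variant it is $N(0,\frac{s^2}{2\phi}I_k)$. For a real $d\times d$ matrix $M$, $\mathrm{PrivSPDMat}(M,s,\phi,c)$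 adds to the entries of $M$ a noise vector drawn from $\nu_{d^2}(s,\phi)$, replaces the result by its symmetric part, and replaces each eigenvalue $\lambda$ of that symmetric matrix by $\max(\lambda,2c)$, keeping the eigenvectors. Let $f:\mathbb R\to\mathbb R$ be convex and differentiable with $|f'|\le 1$, put $f(x,y,\theta)=f(y\,\theta^Tx)$, and let $c,\phi_1,\phi_2,\phi_3>0$ and $\alpha\in(0,1)$. Let $H[f(x,y,\theta)]$ denote the Hessian in $\theta$; at points $\theta$ where $\theta\mapsto f(x,y,\theta)$ is not twice differentiable, any fixed value, measurable in $\theta$, is used. For $\theta\in\mathbb R^d$ put $$H_D(\theta)=\frac1n\sum_{i=1}^n H[f(x_i,y_i,\theta)]+2cI,\qquad \Sigma_D(\theta)=\frac1n\sum_{i=1}^n\nabla_\theta f(x_i,y_i,\theta)\,\nabla_\theta f(x_i,y_i,\theta)^T-4c^2\theta\theta^T ,$$ and let $s_H(\theta),s_\Sigma(\theta)\in[0,\infty)$ be measurable in $\theta$ and at least (for instance, equal to) the $L_2$-sensitivities of $D\mapsto H_D(\theta)$ and $D\mapsto\Sigma_D(\theta)$, respectively; in particular these sensitivities are assumed finite.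 The confidence-interval algorithm for output perturbation, on input $D$, does the following. 1. Output perturbation: $\tilde\theta=\arg\min_\theta\frac1n\sum_{i=1}^n\left[f(x_i,y_i,\theta)+c\|\theta\|_2^2\right]+\beta$ with $\beta\sim\nu_d\!\left(\frac1{nc},\phi_1\right)$, i.e. density proportional to $e^{-nc\phi_1\|\beta\|_2}$ in the DP variant and $N\!\left(0,\frac{1}{2n^2c^2\phi_1}I_d\right)$ in the zCDP variant. 2. $\tilde H=\mathrm{PrivSPDMat}(H_D(\tilde\theta),s_H(\tilde\theta),\phi_2,c)$ and $\tilde\Sigma=\mathrm{PrivSPDMat}(\Sigma_D(\tilde\theta),s_\Sigma(\tilde\theta),\phi_3,c)$, with independent noise. 3. Draw $G_1,\dots,G_m$ i.i.d. from $N(0,\tilde\Sigma)$ and $\beta_1,\dots,\beta_m$ i.i.d. with the law of the noise in step 1 (all fresh and independent), and set $\theta^{(i)}=\tilde\theta+\tilde H^{-1}G_i/\sqrt n-\beta_i$. 4. For each coordinate $j$, let $[\theta_L[j],\theta_R[j]]$ be an interval that covers at least a fraction $1-\alpha$ of $\theta^{(1)}[j],\dots,\theta^{(m)}[j]$, chosen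 by any fixed measurable rule. Output $(\theta_L,\theta_R)$. Then the DP variant of this algorithm satisfies $(\phi_1+\phi_2+\phi_3)$-differential privacy, and its zCDP variant satisfies $(\phi_1+\phi_2+\phi_3)$-zCDP. -/

import Mathlib

open MeasureTheory ProbabilityTheory
open scoped ENNReal NNReal

noncomputable section

namespace DPCI

/-- A record: a feature vector of Euclidean norm one and a label in `{-1, 1}`. -/
structure Record (d : ℕ) where
  x : EuclideanSpace ℝ (Fin d)
  y : ℝ
  norm_x : ‖x‖ = 1
  y_mem : y = 1 ∨ y = -1

/-- A database of `n` records. -/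
abbrev Database (n d : ℕ) : Type := Fin n → Record d

/-- Two databases are neighbours if they differ in the value of (at most) one record. -/
def Neighbor {n d : ℕ} (D D' : Database n d) : Prop :=
  ∃ i, ∀ j, j ≠ i → D j = D' j

/-- A randomized mechanism, given by its output laws, satisfies pure `ε`-differential privacy. -/
structure IsDifferentiallyPrivate {n d : ℕ} {Ω : Type*} [MeasurableSpace Ω]
    (ε : ℝ) (M : Database n d → Measure Ω) : Prop where
  isProbabilityMeasure : ∀ D, IsProbabilityMeasure (M D)
  le : ∀ D D', Neighbor D D' → ∀ V : Set Ω, MeasurableSet V →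
    M D V ≤ ENNReal.ofReal (Real.exp ε) * M D' V

open Classical in
/-- The Rényi divergence `D_a(P ‖ Q) = (a - 1)⁻¹ log ∫ (dP/dQ)^a dQ` of order `a > 1`;
it is `⊤` if `P` is not absolutely continuous with respect to `Q`. -/
def renyiDiv {Ω : Type*} [MeasurableSpace Ω] (a : ℝ) (P Q : Measure Ω) : EReal :=
  if P ≪ Q then
    (((a - 1)⁻¹ : ℝ) : EReal) * ENNReal.log (∫⁻ ω, (P.rnDeriv Q ω) ^ a ∂Q)
  else ⊤

/-- A randomized mechanism satisfies `ρ`-zero-concentrated differential privacy. -/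
structure IsZCDP {n d : ℕ} {Ω : Type*} [MeasurableSpace Ω]
    (ρ : ℝ) (M : Database n d → Measure Ω) : Prop where
  isProbabilityMeasure : ∀ D, IsProbabilityMeasure (M D)
  le : ∀ D D', Neighbor D D' → ∀ a : ℝ, 1 < a →
    renyiDiv a (M D) (M D') ≤ ((ρ * a : ℝ) : EReal)

/-- The `L₂`-sensitivity of a vector-valued function of the database. -/
def l2Sensitivity {n d : ℕ} {ι : Type*} [Fintype ι]
    (g : Database n d → EuclideanSpace ℝ ι) : ℝ≥0∞ :=
  ⨆ (D : Database n d) (D' : Database n d) (_ : Neighbor D D'), edist (g D) (g D')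

/-- The privacy notion that the algorithms are asked to protect. -/
inductive PrivacyMode
  | pureDP
  | zCDP

/-- The spherical Laplace law, with density proportional to `exp (-γ ‖β‖₂)`. -/
def sphericalLaplace (ι : Type*) [Fintype ι] (γ : ℝ) : Measure (EuclideanSpace ℝ ι) :=
  (∫⁻ β : EuclideanSpace ℝ ι, ENNReal.ofReal (Real.exp (-γ * ‖β‖)))⁻¹ •
    (volume : Measure (EuclideanSpace ℝ ι)).withDensity
      (fun β => ENNReal.ofReal (Real.exp (-γ * ‖β‖)))

/-- The isotropic normal law `N(0, v I)`. -/
def isotropicGaussian (ι : Type*) [Fintype ι] (v : ℝ≥0) : Measure (EuclideanSpace ℝ ι) :=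
  (Measure.pi (fun _ : ι => gaussianReal 0 v)).map (WithLp.toLp 2)

open Classical in
/-- The privacy noise for `L₂`-sensitivity `s` and budget `φ`: spherical Laplace with
`γ = φ / s`, respectively `N(0, s² / (2 φ) I)`. For `s = 0` no noise is added. -/
def privacyNoise (mode : PrivacyMode) (ι : Type*) [Fintype ι] (s : ℝ≥0) (φ : ℝ) :
    Measure (EuclideanSpace ℝ ι) :=
  match mode with
  | .pureDP => if s = 0 then Measure.dirac 0 else sphericalLaplace ι (φ / s)
  | .zCDP => isotropicGaussian ι (Real.toNNReal ((s : ℝ) ^ 2 / (2 * φ)))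

/-- The loss of a parameter vector `θ` on a record: `f (y θᵀ x)`. -/
def loss {d : ℕ} (f : ℝ → ℝ) (r : Record d) (θ : EuclideanSpace ℝ (Fin d)) : ℝ :=
  f (r.y * inner ℝ θ r.x)

/-- The regularized empirical risk `(1/n) ∑ᵢ [f (yᵢ θᵀ xᵢ) + c ‖θ‖²]`. -/
def empiricalRisk {n d : ℕ} (f : ℝ → ℝ) (c : ℝ) (D : Database n d)
    (θ : EuclideanSpace ℝ (Fin d)) : ℝ :=
  (1 / (n : ℝ)) * ∑ i, (loss f (D i) θ + c * ‖θ‖ ^ 2)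

/-- The empirical risk minimizer (it exists and is unique for convex `f` and `c > 0`). -/
def erm {n d : ℕ} (f : ℝ → ℝ) (c : ℝ) (D : Database n d) : EuclideanSpace ℝ (Fin d) :=
  Classical.epsilon (fun θ => IsMinOn (empiricalRisk f c D) Set.univ θ)

/-- The noise of output perturbation: privacy noise for sensitivity `1 / (n c)`, that is,
spherical Laplace noise with `γ = n c φ`, respectively `N(0, 1 / (2 n² c² φ) I)`. -/
def outputNoise (mode : PrivacyMode) (n d : ℕ) (c φ : ℝ) :
    Measure (EuclideanSpace ℝ (Fin d)) :=
  privacyNoise mode (Fin d) (Real.toNNReal (1 / (n * c))) φ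

/-- Output perturbation: release the empirical risk minimizer plus noise. -/
def outputPerturb {n d : ℕ} (mode : PrivacyMode) (f : ℝ → ℝ) (c φ : ℝ) (D : Database n d) :
    Measure (EuclideanSpace ℝ (Fin d)) :=
  (outputNoise mode n d c φ).map (fun β => erm f c D + β)

/-- Matrices carry the product (Borel) σ-algebra of their entries. -/
instance matrixMeasurableSpace (d : ℕ) : MeasurableSpace (Matrix (Fin d) (Fin d) ℝ) :=
  inferInstanceAs (MeasurableSpace (Fin d → Fin d → ℝ))

/-- The vector of entries of a matrix. -/
def toVec {d : ℕ} (M : Matrix (Fin d) (Fin d) ℝ) : EuclideanSpace ℝ (Fin d × Fin d) :=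
  WithLp.toLp 2 (fun p => M p.1 p.2)

/-- Reshape a `d²`-dimensional vector to a `d × d` matrix. -/
def toMat {d : ℕ} (η : EuclideanSpace ℝ (Fin d × Fin d)) : Matrix (Fin d) (Fin d) ℝ :=
  Matrix.of (fun i j => η (i, j))

/-- The symmetric part `(M + Mᵀ) / 2`. -/
def symmPart {d : ℕ} (M : Matrix (Fin d) (Fin d) ℝ) : Matrix (Fin d) (Fin d) ℝ :=
  (1 / 2 : ℝ) • (M + M.transpose)

theorem symmPart_isHermitian {d : ℕ} (M : Matrix (Fin d) (Fin d) ℝ) :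
    (symmPart M).IsHermitian := by
  ext i j
  simp [symmPart, mul_add, add_comm]

/-- Symmetrize `M`, take an orthonormal eigen-decomposition `V diag(Λ) Vᵀ`, and replace every
eigenvalue by its maximum with `2 c`. -/
def clipSPD {d : ℕ} (c : ℝ) (M : Matrix (Fin d) (Fin d) ℝ) : Matrix (Fin d) (Fin d) ℝ :=
  let h := symmPart_isHermitian M
  let V : Matrix (Fin d) (Fin d) ℝ := h.eigenvectorUnitary
  V * Matrix.diagonal (fun i => max (h.eigenvalues i) (2 * c)) * V.transpose

/-- The algorithm `PrivSPDMat`: add noise to the entries, then symmetrize and clip. -/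
def privSPDMat {d : ℕ} (mode : PrivacyMode) (M : Matrix (Fin d) (Fin d) ℝ) (s : ℝ≥0)
    (φ c : ℝ) : Measure (Matrix (Fin d) (Fin d) ℝ) :=
  (privacyNoise mode (Fin d × Fin d) s φ).map (fun η => clipSPD c (M + toMat η))

/-- The Hessian matrix of `g` at `θ`. -/
def hessian {d : ℕ} (g : EuclideanSpace ℝ (Fin d) → ℝ) (θ : EuclideanSpace ℝ (Fin d)) :
    Matrix (Fin d) (Fin d) ℝ :=
  Matrix.of (fun j k => (fderiv ℝ (gradient g) θ (EuclideanSpace.single k 1)) j)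

/-- `hess` is a version of the Hessian of the loss: it is the Hessian wherever the loss is twice
differentiable in `θ`, and it follows an arbitrary measurable convention elsewhere (a convex loss
`f` fails to be twice differentiable at most on a null set). -/
structure IsLossHessian {d : ℕ} (f : ℝ → ℝ)
    (hess : Record d → EuclideanSpace ℝ (Fin d) → Matrix (Fin d) (Fin d) ℝ) : Prop where
  measurable : ∀ r, Measurable (hess r)
  eq_hessian : ∀ r θ, DifferentiableAt ℝ (gradient (loss f r)) θ →
    hess r θ = hessian (loss f r) θ

/-- The Hessian of the empirical risk: `(1/n) ∑ᵢ H[f(xᵢ, yᵢ, θ)] + 2 c I`. -/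
def riskHessian {n d : ℕ}
    (hess : Record d → EuclideanSpace ℝ (Fin d) → Matrix (Fin d) (Fin d) ℝ) (c : ℝ)
    (θ : EuclideanSpace ℝ (Fin d)) (D : Database n d) : Matrix (Fin d) (Fin d) ℝ :=
  (1 / (n : ℝ)) • ∑ i, hess (D i) θ + (2 * c) • (1 : Matrix (Fin d) (Fin d) ℝ)

/-- The estimated covariance matrix
`(1/n) ∑ᵢ ∇f(xᵢ, yᵢ, θ) ∇f(xᵢ, yᵢ, θ)ᵀ - 4 c² θ θᵀ`. -/
def gradCovariance {n d : ℕ} (f : ℝ → ℝ) (c : ℝ)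
    (θ : EuclideanSpace ℝ (Fin d)) (D : Database n d) : Matrix (Fin d) (Fin d) ℝ :=
  (1 / (n : ℝ)) • ∑ i, Matrix.of (fun j k =>
      (gradient (loss f (D i)) θ) j * (gradient (loss f (D i)) θ) k)
    - (4 * c ^ 2) • Matrix.of (fun j k => θ j * θ k)

/-- A measurable rule that selects an interval covering at least the fraction `1 - α` of `m`
given real numbers. -/
structure IsConfidenceRule {m : ℕ} (α : ℝ) (ci : (Fin m → ℝ) → ℝ × ℝ) : Prop where
  measurable : Measurable ci
  ordered : ∀ z, (ci z).1 ≤ (ci z).2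
  covers : ∀ z, (1 - α) * m ≤ (Nat.card {i : Fin m // z i ∈ Set.Icc (ci z).1 (ci z).2} : ℝ)

/-- The endpoints `(θ_L, θ_R)` of the coordinatewise confidence intervals of `m` samples. -/
def intervals {m d : ℕ} (ci : (Fin m → ℝ) → ℝ × ℝ)
    (θs : Fin m → EuclideanSpace ℝ (Fin d)) :
    EuclideanSpace ℝ (Fin d) × EuclideanSpace ℝ (Fin d) :=
  (WithLp.toLp 2 (fun j => (ci (fun i => θs i j)).1),
    WithLp.toLp 2 (fun j => (ci (fun i => θs i j)).2))

/-- The sample `θ̃ + H̃⁻¹ G / √n - β` from the approximate law of the true parameter. -/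
def paramSample {d : ℕ} (n : ℕ) (θ : EuclideanSpace ℝ (Fin d)) (H : Matrix (Fin d) (Fin d) ℝ)
    (G β : EuclideanSpace ℝ (Fin d)) : EuclideanSpace ℝ (Fin d) :=
  θ + (1 / Real.sqrt n) • WithLp.toLp 2 (H⁻¹.mulVec G) - β

/-- The law of the output `(θ_L, θ_R)` of the confidence interval algorithm for models trained
by output perturbation. The inputs `sensH θ` and `sensS θ` are the sensitivities handed to
`PrivSPDMat` for the Hessian and the covariance matrix at the released parameter `θ`. -/
def ciOutput {n d : ℕ} (mode : PrivacyMode) (f : ℝ → ℝ)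
    (hess : Record d → EuclideanSpace ℝ (Fin d) → Matrix (Fin d) (Fin d) ℝ)
    (sensH sensS : EuclideanSpace ℝ (Fin d) → ℝ≥0) (c φ₁ φ₂ φ₃ : ℝ)
    (m : ℕ) (ci : (Fin m → ℝ) → ℝ × ℝ) (D : Database n d) :
    Measure (EuclideanSpace ℝ (Fin d) × EuclideanSpace ℝ (Fin d)) :=
  (outputPerturb mode f c φ₁ D).bind fun θ =>
  (privSPDMat mode (riskHessian hess c θ D) (sensH θ) φ₂ c).bind fun H =>
  (privSPDMat mode (gradCovariance f c θ D) (sensS θ) φ₃ c).bind fun S =>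
  (Measure.pi fun _ : Fin m => multivariateGaussian 0 S).bind fun G =>
  (Measure.pi fun _ : Fin m => outputNoise mode n d c φ₁).map fun β =>
    intervals ci (fun i => paramSample n θ H (G i) (β i))

end DPCI

end

noncomputable section

namespace DPCI

/-! Both privacy notions are instances of one inequality between output laws, `HolderDominated K q P
Q`. Pure privacy is the case `q = 1`. A Rényi bound of order `a` is the case of `q` conjugate to
`a`: one direction is Hölder's inequality for the density, the other
(`HolderDominated.lintegral_rnDeriv_rpow_le`) is the dual description of the `Lᵃ` norm. The benefit
of this form is that adaptive composition needs no conditional densities. Apply the inner inequality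
for each released value, then the outer one to the function `(∫ F^q dη)^(1/q)`; the powers cancel
and the constants multiply. With constants `exp (t φ)`, the budgets therefore add. The algorithm
makes three data-dependent releases, each a deterministic image of a vector plus noise. For
spherical Laplace noise the density ratio is controlled by the triangle inequality, for Gaussian
noise by an explicit exponential moment. The minimizer has sensitivity `1 / (n c)` because the risk
grows quadratically around it while each loss is 1-Lipschitz (`dist_erm_le`); the sensitivities of
the two matrices are bounded by hypothesis at every `θ`. All later sampling is the same kernel for
every database and costs the factor 1. The remaining work is measurability of each stage in the
values released before it, on which the composition rests. -/

/-- The Hölder-type bound `∫ F dP ≤ K (∫ F^q dQ)^(1/q)` for all nonnegative measurable `F`.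
For `q = 1` this is pure differential privacy with `K = exp ε`; for `q` conjugate to `a` it says
that the `a`-th moment of the density of `P` with respect to `Q` is at most `K ^ a`. -/
def HolderDominated {Ω : Type*} [MeasurableSpace Ω] (K : ℝ≥0∞) (q : ℝ) (P Q : Measure Ω) : Prop :=
  ∀ F : Ω → ℝ≥0∞, Measurable F → ∫⁻ ω, F ω ∂P ≤ K * (∫⁻ ω, F ω ^ q ∂Q) ^ (1 / q)

/-! ### Hölder domination and its links to privacy and Rényi divergence -/

section Dominated

variable {Ω Ω' : Type*} [MeasurableSpace Ω] [MeasurableSpace Ω']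

/-- On a probability space the `L¹` norm is at most the `L^q` norm. -/
theorem HolderDominated.refl {q : ℝ} (hq : 1 ≤ q) (P : Measure Ω) [IsProbabilityMeasure P] :
    HolderDominated 1 q P P := by
  intro F hF
  have h := eLpNorm'_le_eLpNorm'_of_exponent_le (f := F) (μ := P) one_pos hq
    hF.aestronglyMeasurable
  simpa [eLpNorm'] using h

theorem HolderDominated.mono {K K' : ℝ≥0∞} {q : ℝ} {P Q : Measure Ω}
    (h : HolderDominated K q P Q) (hK : K ≤ K') : HolderDominated K' q P Q :=
  fun F hF => (h F hF).trans (by gcongr)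

/-- Adaptive composition. -/
theorem HolderDominated.bind {K₁ K₂ : ℝ≥0∞} {q : ℝ} (hq : 1 ≤ q) {P Q : Measure Ω}
    (h : HolderDominated K₁ q P Q) {κ η : Ω → Measure Ω'} (hκ : Measurable κ) (hη : Measurable η)
    (hκη : ∀ ω, HolderDominated K₂ q (κ ω) (η ω)) :
    HolderDominated (K₁ * K₂) q (P.bind κ) (Q.bind η) := by
  intro F hF
  have hq0 : q ≠ 0 := by positivity
  have hFq : Measurable fun x => F x ^ q := hF.pow_const q
  have hm : Measurable fun ω => ∫⁻ x, F x ^ q ∂(η ω) :=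
    (Measure.measurable_lintegral hFq).comp hη
  rw [Measure.lintegral_bind hκ.aemeasurable hF.aemeasurable,
    Measure.lintegral_bind hη.aemeasurable hFq.aemeasurable]
  calc ∫⁻ ω, ∫⁻ x, F x ∂(κ ω) ∂P
      ≤ ∫⁻ ω, K₂ * (∫⁻ x, F x ^ q ∂(η ω)) ^ (1 / q) ∂P := lintegral_mono fun ω => hκη ω F hF
    _ = K₂ * ∫⁻ ω, (∫⁻ x, F x ^ q ∂(η ω)) ^ (1 / q) ∂P :=
        lintegral_const_mul _ (hm.pow_const _)
    _ ≤ K₂ * (K₁ * (∫⁻ ω, ((∫⁻ x, F x ^ q ∂(η ω)) ^ (1 / q)) ^ q ∂Q) ^ (1 / q)) := by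
        gcongr
        exact h _ (hm.pow_const _)
    _ = K₁ * K₂ * (∫⁻ ω, ∫⁻ x, F x ^ q ∂(η ω) ∂Q) ^ (1 / q) := by
        simp_rw [← ENNReal.rpow_mul, one_div_mul_cancel hq0, ENNReal.rpow_one]
        ring

/-- Post-processing by a deterministic map. -/
theorem HolderDominated.map {K : ℝ≥0∞} {q : ℝ} {P Q : Measure Ω}
    (h : HolderDominated K q P Q) {T : Ω → Ω'} (hT : Measurable T) :
    HolderDominated K q (P.map T) (Q.map T) := by
  intro F hF
  rw [lintegral_map hF hT, lintegral_map (hF.pow_const q) hT]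
  exact h _ (hF.comp hT)

/-- Hölder's inequality: a moment bound on a density gives domination. -/
theorem holderDominated_withDensity {p q : ℝ} (hpq : p.HolderConjugate q) {Q : Measure Ω}
    {g : Ω → ℝ≥0∞} (hg : Measurable g) :
    HolderDominated ((∫⁻ ω, g ω ^ p ∂Q) ^ (1 / p)) q (Q.withDensity g) Q := by
  intro F hF
  rw [lintegral_withDensity_eq_lintegral_mul _ hg hF]
  exact ENNReal.lintegral_mul_le_Lp_mul_Lq Q hpq hg.aemeasurable hF.aemeasurable

theorem HolderDominated.apply_le {K : ℝ≥0∞} {P Q : Measure Ω} (h : HolderDominated K 1 P Q)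
    {V : Set Ω} (hV : MeasurableSet V) : P V ≤ K * Q V := by
  simpa [lintegral_indicator_one hV] using h (V.indicator 1) (measurable_one.indicator hV)

theorem HolderDominated.absolutelyContinuous {K : ℝ≥0∞} {q : ℝ} (hq : 0 < q) {P Q : Measure Ω}
    (h : HolderDominated K q P Q) : P ≪ Q := by
  refine Measure.AbsolutelyContinuous.mk fun V hV hQ => ?_
  have h1 := h (V.indicator 1) (measurable_one.indicator hV)
  have h2 : ∀ ω, V.indicator (1 : Ω → ℝ≥0∞) ω ^ q = V.indicator 1 ω := fun ω => by
    by_cases hω : ω ∈ V <;> simp [hω, hq]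
  simp_rw [h2] at h1
  rw [lintegral_indicator_one hV, lintegral_indicator_one hV, hQ,
    ENNReal.zero_rpow_of_pos (by positivity)] at h1
  simpa using h1

/-- Converse of Hölder: test the domination on `r ^ (p - 1)`, where `r` is the density, and cancel a
power of the moment. The cancellation needs a finite moment, so `r` is first truncated at `k`;
monotone convergence then removes the truncation. -/
theorem HolderDominated.lintegral_rnDeriv_rpow_le {K : ℝ≥0∞} {p q : ℝ}
    (hpq : p.HolderConjugate q) {P Q : Measure Ω} [IsProbabilityMeasure P] [IsProbabilityMeasure Q]
    (h : HolderDominated K q P Q) : ∫⁻ ω, P.rnDeriv Q ω ^ p ∂Q ≤ K ^ p := by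
  have hp := hpq.pos
  have hq := hpq.symm.pos
  have hp1 : 0 < p - 1 := by linarith [hpq.lt]
  set r := P.rnDeriv Q with hr
  have hrm : Measurable r := Measure.measurable_rnDeriv P Q
  have hP : Q.withDensity r = P := Measure.withDensity_rnDeriv_eq P Q (h.absolutelyContinuous hq)
  have key : ∀ k : ℕ, ∫⁻ ω, min (r ω) k ^ p ∂Q ≤ K ^ p := by
    intro k
    set t : Ω → ℝ≥0∞ := fun ω => min (r ω) k with ht
    have htm : Measurable t := hrm.min measurable_const
    set I := ∫⁻ ω, t ω ^ p ∂Q with hI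
    have hItop : I ≠ ∞ := by
      refine ne_top_of_le_ne_top (b := (k : ℝ≥0∞) ^ p)
        (ENNReal.rpow_ne_top_of_nonneg hp.le (by simp)) ?_
      calc I ≤ ∫⁻ _, (k : ℝ≥0∞) ^ p ∂Q :=
            lintegral_mono fun ω => ENNReal.rpow_le_rpow (min_le_right _ _) hp.le
        _ = _ := by simp
    have h1 : I ≤ ∫⁻ ω, t ω ^ (p - 1) ∂P := by
      rw [← hP, lintegral_withDensity_eq_lintegral_mul _ hrm (htm.pow_const _)]
      refine lintegral_mono fun ω => ?_
      calc t ω ^ p = t ω ^ (1 + (p - 1)) := by ring_nf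
        _ = t ω * t ω ^ (p - 1) := by
            rw [ENNReal.rpow_add_of_nonneg _ _ zero_le_one hp1.le, ENNReal.rpow_one]
        _ ≤ r ω * t ω ^ (p - 1) := by gcongr; exact min_le_left _ _
    -- Since `(p - 1) q = p`, the right-hand side again contains `I`.
    have h2 := h (fun ω => t ω ^ (p - 1)) (htm.pow_const _)
    simp_rw [← ENNReal.rpow_mul, hpq.sub_one_mul_conj] at h2
    have h3 : I ≤ K * I ^ (1 / q) := h1.trans h2
    rcases eq_or_ne I 0 with h0 | h0
    · simp [h0]
    have hIq0 : I ^ (1 / q) ≠ 0 := by simp [ENNReal.rpow_eq_zero_iff, h0, hItop]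
    have hIqt : I ^ (1 / q) ≠ ∞ := ENNReal.rpow_ne_top_of_nonneg (by positivity) hItop
    have h4 : I ^ (1 / p) ≤ K := by
      have h5 : I ^ (1 / p) * I ^ (1 / q) = I := by
        rw [← ENNReal.rpow_add _ _ h0 hItop, one_div, one_div, hpq.inv_add_inv_eq_one,
          ENNReal.rpow_one]
      rw [← ENNReal.mul_le_mul_iff_left hIq0 hIqt, h5]
      exact h3
    calc I = (I ^ (1 / p)) ^ p := by
          rw [← ENNReal.rpow_mul, one_div_mul_cancel hp.ne', ENNReal.rpow_one]
      _ ≤ K ^ p := ENNReal.rpow_le_rpow h4 hp.le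
  have hsup : ∀ ω, r ω ^ p = ⨆ k : ℕ, min (r ω) k ^ p := by
    intro ω
    have h1 : (⨆ k : ℕ, min (r ω) (k : ℝ≥0∞)) = r ω := by
      rw [← inf_iSup_eq, ENNReal.iSup_natCast, inf_top_eq]
    conv_lhs => rw [← h1]
    exact (ENNReal.orderIsoRpow p hp).map_iSup _
  simp_rw [hsup]
  rw [lintegral_iSup]
  · exact iSup_le key
  · exact fun k => (hrm.min measurable_const).pow_const p
  · intro i j hij ω
    dsimp only
    gcongr

/-- The moment bound for all pairs of conjugate exponents bounds the Rényi divergence. -/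
theorem HolderDominated.renyiDiv_le {a ρ : ℝ} (ha : 1 < a) {P Q : Measure Ω}
    [IsProbabilityMeasure P] [IsProbabilityMeasure Q]
    (h : HolderDominated (ENNReal.ofReal (Real.exp ((a - 1) * ρ))) (a / (a - 1)) P Q) :
    renyiDiv a P Q ≤ ((ρ * a : ℝ) : EReal) := by
  have hpq : a.HolderConjugate (a / (a - 1)) := Real.HolderConjugate.conjExponent ha
  have ha1 : 0 < a - 1 := sub_pos.2 ha
  rw [renyiDiv, if_pos (h.absolutelyContinuous hpq.symm.pos)]
  have h1 := h.lintegral_rnDeriv_rpow_le hpq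
  have h2 : ENNReal.ofReal (Real.exp ((a - 1) * ρ)) ^ a =
      ENNReal.ofReal (Real.exp ((a - 1) * (ρ * a))) := by
    rw [ENNReal.ofReal_rpow_of_pos (Real.exp_pos _), ← Real.exp_mul]
    ring_nf
  rw [h2] at h1
  have h3 : ENNReal.log (∫⁻ ω, P.rnDeriv Q ω ^ a ∂Q) ≤ (((a - 1) * (ρ * a) : ℝ) : EReal) := by
    refine (ENNReal.log_monotone h1).trans ?_
    rw [ENNReal.log_ofReal_of_pos (Real.exp_pos _), Real.log_exp]
  calc (((a - 1)⁻¹ : ℝ) : EReal) * ENNReal.log (∫⁻ ω, P.rnDeriv Q ω ^ a ∂Q)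
      ≤ (((a - 1)⁻¹ : ℝ) : EReal) * (((a - 1) * (ρ * a) : ℝ) : EReal) :=
        mul_le_mul_of_nonneg_left h3 (by exact_mod_cast (inv_pos.2 ha1).le)
    _ = ((ρ * a : ℝ) : EReal) := by
        rw [← EReal.coe_mul, inv_mul_cancel_left₀ ha1.ne']

end Dominated

/-! ### Measurable families of measures; densities of product measures -/

section ParametrizedMeasures

variable {Ω Ω' Ω'' : Type*} [MeasurableSpace Ω] [MeasurableSpace Ω'] [MeasurableSpace Ω'']

/-- The mass of `V` is the `κ ω`-mass of a section of a measurable subset of the product. Writing a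
law as such an image is how the stages below are shown to depend measurably on earlier releases. -/
theorem measurable_parametrized_map {κ : Ω → Measure Ω'} (hκ : Measurable κ)
    [hP : ∀ ω, IsProbabilityMeasure (κ ω)] {g : Ω → Ω' → Ω''}
    (hg : Measurable (Function.uncurry g)) : Measurable fun ω => (κ ω).map (g ω) := by
  let k : Kernel Ω Ω' := ⟨κ, hκ⟩
  have : IsMarkovKernel k := ⟨hP⟩
  refine Measure.measurable_of_measurable_coe _ fun V hV => ?_
  have h : ∀ ω, (κ ω).map (g ω) V = k ω (Prod.mk ω ⁻¹' (Function.uncurry g ⁻¹' V)) := fun ω => by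
    exact Measure.map_apply (hg.comp measurable_prodMk_left) hV
  simp_rw [h]
  exact Kernel.measurable_kernel_prodMk_left (hg hV)

theorem measurable_parametrized_bind {κ : Ω → Measure Ω'} (hκ : Measurable κ)
    [hP : ∀ ω, IsProbabilityMeasure (κ ω)] {g : Ω → Ω' → Measure Ω''}
    (hg : Measurable (Function.uncurry g)) : Measurable fun ω => (κ ω).bind (g ω) := by
  let k : Kernel Ω Ω' := ⟨κ, hκ⟩
  have : IsMarkovKernel k := ⟨hP⟩
  refine Measure.measurable_of_measurable_coe _ fun V hV => ?_
  have h : ∀ ω, (κ ω).bind (g ω) V = ∫⁻ η, g ω η V ∂(k ω) := fun ω => by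
    exact Measure.bind_apply hV (hg.comp measurable_prodMk_left).aemeasurable
  simp_rw [h]
  exact Measurable.lintegral_kernel_prod_right ((Measure.measurable_coe hV).comp hg)

theorem isProbabilityMeasure_bind {P : Measure Ω} [IsProbabilityMeasure P] {κ : Ω → Measure Ω'}
    (hκ : Measurable κ) [hP : ∀ ω, IsProbabilityMeasure (κ ω)] :
    IsProbabilityMeasure (P.bind κ) :=
  ⟨by simp [Measure.bind_apply MeasurableSet.univ hκ.aemeasurable]⟩

theorem lintegral_pi_prod {ι : Type*} [Fintype ι] (μ : ι → Measure Ω)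
    [∀ i, IsProbabilityMeasure (μ i)] {g : ι → Ω → ℝ≥0∞} (hg : ∀ i, Measurable (g i)) :
    ∫⁻ x, ∏ i, g i (x i) ∂(Measure.pi μ) = ∏ i, ∫⁻ x, g i x ∂(μ i) := by
  refine (lintegral_prod_eq_prod_lintegral_of_indepFun Finset.univ (fun i (x : ι → Ω) => g i (x i))
    (iIndepFun_pi fun i => (hg i).aemeasurable)
    (fun i => (hg i).comp (measurable_pi_apply i))).trans ?_
  refine Finset.prod_congr rfl fun i _ => ?_
  exact (measurePreserving_eval μ i).lintegral_comp (hg i)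

/-- Both measures agree on boxes, where the indicator of the box splits into a product over the
coordinates. -/
theorem pi_withDensity {ι : Type*} [Fintype ι] (μ : ι → Measure Ω)
    [∀ i, IsProbabilityMeasure (μ i)] {g : ι → Ω → ℝ≥0∞} (hg : ∀ i, Measurable (g i))
    [∀ i, IsProbabilityMeasure ((μ i).withDensity (g i))] :
    Measure.pi (fun i => (μ i).withDensity (g i)) =
      (Measure.pi μ).withDensity (fun x => ∏ i, g i (x i)) := by
  refine Measure.pi_eq fun s hs => ?_
  have hpi : MeasurableSet (Set.univ.pi s) := MeasurableSet.univ_pi hs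
  rw [withDensity_apply _ hpi, ← lintegral_indicator hpi]
  have h : ∀ x : ι → Ω, (Set.univ.pi s).indicator (fun x => ∏ i, g i (x i)) x =
      ∏ i, (s i).indicator (g i) (x i) := by
    intro x
    by_cases hx : x ∈ Set.univ.pi s
    · rw [Set.indicator_of_mem hx]
      exact Finset.prod_congr rfl fun i _ =>
        (Set.indicator_of_mem (hx i (Set.mem_univ i)) _).symm
    · rw [Set.indicator_of_notMem hx]
      simp only [Set.mem_pi, Set.mem_univ, forall_true_left, not_forall] at hx
      obtain ⟨i, hi⟩ := hx
      exact (Finset.prod_eq_zero (Finset.mem_univ i) (Set.indicator_of_notMem hi _)).symm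
  simp_rw [h]
  rw [lintegral_pi_prod μ fun i => (hg i).indicator (hs i)]
  exact Finset.prod_congr rfl fun i _ => by
    rw [lintegral_indicator (hs i), withDensity_apply _ (hs i)]

end ParametrizedMeasures

/-! ### Spherical Laplace noise -/

section Laplace

variable {ι : Type*} [Fintype ι]

theorem integrable_exp_neg_mul_norm {E : Type*} [NormedAddCommGroup E] [NormedSpace ℝ E]
    [FiniteDimensional ℝ E] [MeasurableSpace E] [BorelSpace E] (μ : Measure E)
    [μ.IsAddHaarMeasure] {γ : ℝ} (hγ : 0 < γ) :
    Integrable (fun β : E => Real.exp (-γ * ‖β‖)) μ := by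
  -- `N` exceeds the dimension, so `(1 + ‖β‖) ^ (-N)` is integrable. The constant in the majorant
  -- comes from `x ^ N / N! ≤ exp x` at `x = γ (1 + ‖β‖)`.
  set N := Module.finrank ℝ E + 1 with hN
  have h := (integrable_one_add_norm (E := E) (μ := μ) (r := N) (by simp [hN])).const_mul
    (N.factorial / γ ^ N * Real.exp γ)
  refine h.mono' (by fun_prop) (Filter.Eventually.of_forall fun β => ?_)
  have h1 := Real.pow_div_factorial_le_exp (x := γ * (1 + ‖β‖)) (by positivity) N
  have h2 : 0 < (1 + ‖β‖) ^ N := by positivity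
  rw [Real.norm_of_nonneg (Real.exp_pos _).le, Real.rpow_neg (by positivity), Real.rpow_natCast,
    ← div_eq_mul_inv, le_div_iff₀ h2]
  rw [mul_pow, div_le_iff₀ (by positivity)] at h1
  have h3 : (1 + ‖β‖) ^ N ≤ N.factorial / γ ^ N * Real.exp (γ * (1 + ‖β‖)) := by
    rw [div_mul_eq_mul_div, le_div_iff₀ (by positivity)]
    linarith
  calc Real.exp (-γ * ‖β‖) * (1 + ‖β‖) ^ N
      ≤ Real.exp (-γ * ‖β‖) * (N.factorial / γ ^ N * Real.exp (γ * (1 + ‖β‖))) := by gcongr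
    _ = N.factorial / γ ^ N * (Real.exp (-γ * ‖β‖) * Real.exp (γ * (1 + ‖β‖))) := by ring
    _ = N.factorial / γ ^ N * Real.exp γ := by
        rw [← Real.exp_add]
        ring_nf

theorem isProbabilityMeasure_sphericalLaplace {γ : ℝ} (hγ : 0 < γ) :
    IsProbabilityMeasure (sphericalLaplace ι γ) := by
  refine ⟨?_⟩
  rw [sphericalLaplace, Measure.smul_apply, withDensity_apply _ MeasurableSet.univ,
    Measure.restrict_univ, smul_eq_mul]
  refine ENNReal.inv_mul_cancel ?_ ?_
  · rw [Ne, lintegral_eq_zero_iff (by fun_prop)]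
    intro h
    have : ∀ᵐ _ : EuclideanSpace ℝ ι, False := h.mono fun β hβ => by
      simp only [Pi.zero_apply, ENNReal.ofReal_eq_zero] at hβ
      exact absurd hβ (not_le.2 (Real.exp_pos _))
    exact NeZero.ne (volume : Measure (EuclideanSpace ℝ ι)) (by simpa using this)
  · exact (hasFiniteIntegral_iff_ofReal
      (Filter.Eventually.of_forall fun β => (Real.exp_pos _).le)).1
        (integrable_exp_neg_mul_norm volume hγ).hasFiniteIntegral |>.ne

/-- Measurability in the rate `γ` matters because the matrix noise scales depend on the released
parameter. -/
theorem measurable_sphericalLaplace : Measurable (sphericalLaplace ι) := by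
  have hd : Measurable fun p : ℝ × EuclideanSpace ℝ ι =>
      ENNReal.ofReal (Real.exp (-p.1 * ‖p.2‖)) := by fun_prop
  refine Measure.measurable_of_measurable_coe _ fun V hV => ?_
  simp_rw [sphericalLaplace, Measure.smul_apply, withDensity_apply _ hV, smul_eq_mul]
  exact (Measurable.lintegral_prod_right hd).inv.mul (Measurable.lintegral_prod_right hd)

/-- Translation invariance moves the shift from the test function into the density; the normalizing
constants coincide, and the triangle inequality bounds the ratio of the exponentials. -/
theorem sphericalLaplace_shift_dominated {γ : ℝ} (hγ : 0 ≤ γ) (u w : EuclideanSpace ℝ ι) :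
    HolderDominated (ENNReal.ofReal (Real.exp (γ * dist u w))) 1
      ((sphericalLaplace ι γ).map (u + ·)) ((sphericalLaplace ι γ).map (w + ·)) := by
  intro F hF
  have key : ∀ v : EuclideanSpace ℝ ι, ∫⁻ x, F x ∂((sphericalLaplace ι γ).map (v + ·)) =
      (∫⁻ β : EuclideanSpace ℝ ι, ENNReal.ofReal (Real.exp (-γ * ‖β‖)))⁻¹ *
        ∫⁻ x, ENNReal.ofReal (Real.exp (-γ * ‖-v + x‖)) * F x := by
    intro v
    rw [lintegral_map hF (by fun_prop), sphericalLaplace, lintegral_smul_measure,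
      lintegral_withDensity_eq_lintegral_mul _ (by fun_prop) (by fun_prop),
      smul_eq_mul]
    congr 1
    rw [← lintegral_add_left_eq_self _ (-v)]
    simp
  simp only [ENNReal.rpow_one, div_one]
  rw [key u, key w, mul_left_comm]
  refine mul_le_mul_right ?_ _
  rw [← lintegral_const_mul _ (by fun_prop)]
  refine lintegral_mono fun x => ?_
  rw [← mul_assoc, ← ENNReal.ofReal_mul (Real.exp_pos _).le, ← Real.exp_add]
  gcongr
  have h : ‖-w + x‖ ≤ ‖-u + x‖ + dist u w := by
    rw [dist_eq_norm]
    calc ‖-w + x‖ = ‖(-u + x) + (u - w)‖ := by congr 1; abel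
      _ ≤ _ := norm_add_le _ _
  nlinarith

end Laplace

/-! ### Gaussian noise -/

section Gaussian

variable {ι : Type*} [Fintype ι]

instance isProbabilityMeasure_isotropicGaussian (v : ℝ≥0) :
    IsProbabilityMeasure (isotropicGaussian ι v) :=
  Measure.isProbabilityMeasure_map (by fun_prop)

/-- The density of `N(w, v)` with respect to `N(0, v)`. -/
def gaussianTilt (v : ℝ≥0) (w x : ℝ) : ℝ≥0∞ :=
  ENNReal.ofReal (Real.exp ((2 * x * w - w ^ 2) / (2 * v)))

theorem measurable_gaussianTilt (v : ℝ≥0) (w : ℝ) : Measurable (gaussianTilt v w) := by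
  unfold gaussianTilt
  fun_prop

theorem gaussianReal_withDensity_tilt {v : ℝ≥0} (hv : v ≠ 0) (w : ℝ) :
    (gaussianReal 0 v).withDensity (gaussianTilt v w) = gaussianReal w v := by
  rw [gaussianReal_of_var_ne_zero _ hv, gaussianReal_of_var_ne_zero _ hv,
    ← withDensity_mul _ (measurable_gaussianPDF 0 v) (measurable_gaussianTilt v w)]
  congr 1
  ext x
  rw [Pi.mul_apply, gaussianPDF, gaussianPDF, gaussianTilt,
    ← ENNReal.ofReal_mul (gaussianPDFReal_nonneg _ _ _), gaussianPDFReal, gaussianPDFReal,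
    mul_assoc, ← Real.exp_add]
  congr 3
  ring

/-- The `p`-th power of the tilt is a constant times `exp (p w x / v)`, so the moment is a value of
the Gaussian moment generating function. -/
theorem lintegral_gaussianTilt_rpow {v : ℝ≥0} (hv : v ≠ 0) (w : ℝ) (p : ℝ) :
    ∫⁻ x, gaussianTilt v w x ^ p ∂(gaussianReal 0 v) =
      ENNReal.ofReal (Real.exp (p * (p - 1) / (2 * v) * w ^ 2)) := by
  have hv' : (v : ℝ) ≠ 0 := by exact_mod_cast hv
  have h1 : ∀ x, gaussianTilt v w x ^ p = ENNReal.ofReal (Real.exp (-(p * w ^ 2 / (2 * v)))) *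
      ENNReal.ofReal (Real.exp (p * w / v * x)) := by
    intro x
    rw [gaussianTilt, ENNReal.ofReal_rpow_of_pos (Real.exp_pos _), ← Real.exp_mul,
      ← ENNReal.ofReal_mul (Real.exp_pos _).le, ← Real.exp_add]
    congr 2
    field_simp
    ring
  simp_rw [h1]
  rw [lintegral_const_mul _ (by fun_prop), ← ofReal_integral_eq_lintegral_ofReal
    (integrable_exp_mul_gaussianReal _) (Filter.Eventually.of_forall fun x => (Real.exp_pos _).le),
    ← ENNReal.ofReal_mul (Real.exp_pos _).le]
  have h2 := congrFun (mgf_fun_id_gaussianReal (μ := 0) (v := v)) (p * w / v)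
  rw [mgf] at h2
  rw [h2, ← Real.exp_add]
  congr 2
  field_simp
  ring

/-- The density of the shifted law is a product of one-dimensional tilts, so its `p`-th moment is a
product of exponentials with total exponent `p (p - 1) / (2 v) * ‖w‖ ^ 2`. The `p`-th root in
Hölder's inequality removes the factor `p`. -/
theorem isotropicGaussian_shift_dominated_zero {p q : ℝ} (hpq : p.HolderConjugate q) {v : ℝ≥0}
    (hv : v ≠ 0) (w : EuclideanSpace ℝ ι) :
    HolderDominated (ENNReal.ofReal (Real.exp ((p - 1) / (2 * v) * ‖w‖ ^ 2))) q
      ((isotropicGaussian ι v).map (w + ·)) (isotropicGaussian ι v) := by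
  have hp := hpq.pos
  have hprob : ∀ i : ι, IsProbabilityMeasure
      ((gaussianReal 0 v).withDensity (gaussianTilt v (w i))) := fun i => by
    rw [gaussianReal_withDensity_tilt hv]
    infer_instance
  have h1 : (isotropicGaussian ι v).map (w + ·) =
      (Measure.pi fun i => gaussianReal (w i) v).map (WithLp.toLp 2) := by
    have h2 : (Measure.pi fun i => gaussianReal (w i) v) =
        (Measure.pi fun _ : ι => gaussianReal 0 v).map fun x i => w i + x i := by
      rw [Measure.pi_map_pi (f := fun i x => w i + x) fun i => by fun_prop]
      simp_rw [gaussianReal_map_const_add, zero_add]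
    rw [h2, isotropicGaussian, Measure.map_map (by fun_prop) (by fun_prop),
      Measure.map_map (by fun_prop) (by fun_prop)]
    rfl
  rw [h1, isotropicGaussian]
  refine HolderDominated.map ?_ (by fun_prop)
  have h3 := holderDominated_withDensity hpq (Q := Measure.pi fun _ : ι => gaussianReal 0 v)
    (g := fun x => ∏ i, gaussianTilt v (w i) (x i))
    (Finset.measurable_prod _ fun i _ =>
      (measurable_gaussianTilt v (w i)).comp (measurable_pi_apply i))
  rw [← pi_withDensity _ fun i => measurable_gaussianTilt v (w i)] at h3
  simp_rw [gaussianReal_withDensity_tilt hv] at h3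
  refine h3.mono (le_of_eq ?_)
  simp_rw [← ENNReal.prod_rpow_of_nonneg hp.le]
  rw [lintegral_pi_prod _ fun i => (measurable_gaussianTilt v (w i)).pow_const p]
  simp_rw [lintegral_gaussianTilt_rpow hv]
  rw [← ENNReal.ofReal_prod_of_nonneg fun i _ => (Real.exp_pos _).le, ← Real.exp_sum,
    ← Finset.mul_sum, ENNReal.ofReal_rpow_of_pos (Real.exp_pos _), ← Real.exp_mul,
    EuclideanSpace.norm_sq_eq]
  simp_rw [Real.norm_eq_abs, sq_abs]
  congr 2
  field_simp

theorem isotropicGaussian_shift_dominated {p q : ℝ} (hpq : p.HolderConjugate q) {v : ℝ≥0}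
    (hv : v ≠ 0) (u w : EuclideanSpace ℝ ι) :
    HolderDominated (ENNReal.ofReal (Real.exp ((p - 1) / (2 * v) * dist u w ^ 2))) q
      ((isotropicGaussian ι v).map (u + ·)) ((isotropicGaussian ι v).map (w + ·)) := by
  have h := (isotropicGaussian_shift_dominated_zero hpq hv (u - w)).map
    (T := (w + ·)) (by fun_prop)
  rw [Measure.map_map (by fun_prop) (by fun_prop)] at h
  rw [dist_eq_norm]
  convert h using 3
  ext x : 1
  simp only [Function.comp_apply, ← add_assoc, add_sub_cancel]

/-- Represents all variances, including the degenerate `v = 0`, as images of one fixed law;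
measurability in `v` follows without a case split. -/
theorem isotropicGaussian_eq_map_smul (v : ℝ≥0) :
    isotropicGaussian ι v = (isotropicGaussian ι 1).map (fun x => Real.sqrt v • x) := by
  have h : (Measure.pi fun _ : ι => gaussianReal 0 v) =
      (Measure.pi fun _ : ι => gaussianReal 0 1).map fun x i => Real.sqrt v * x i := by
    rw [Measure.pi_map_pi (f := fun _ x => Real.sqrt v * x) fun i => by fun_prop]
    congr with i : 1
    rw [gaussianReal_map_const_mul, mul_zero, mul_one]
    congr 1
    ext
    simp
  rw [isotropicGaussian, isotropicGaussian, h, Measure.map_map (by fun_prop) (by fun_prop),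
    Measure.map_map (by fun_prop) (by fun_prop)]
  rfl

theorem measurable_isotropicGaussian : Measurable (isotropicGaussian ι) := by
  rw [show isotropicGaussian ι = _ from funext isotropicGaussian_eq_map_smul]
  exact measurable_parametrized_map measurable_const (by unfold Function.uncurry; fun_prop)

end Gaussian

/-! ### The additive noise mechanism in both modes -/

section PrivacyNoise

variable {ι : Type*} [Fintype ι]

/-- `q` is the exponent, and `exp (t φ)` the constant, for which the noise of budget `φ` makes
neighbouring outputs Hölder dominated; in the zCDP mode, `t + 1` is the order of the divergence. -/
def IsPrivacyExponent (mode : PrivacyMode) (t q : ℝ) : Prop :=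
  match mode with
  | .pureDP => t = 1 ∧ q = 1
  | .zCDP => 0 < t ∧ q = (t + 1) / t

theorem IsPrivacyExponent.one_le {mode : PrivacyMode} {t q : ℝ}
    (h : IsPrivacyExponent mode t q) : 1 ≤ q := by
  cases mode with
  | pureDP => exact h.2.ge
  | zCDP =>
    obtain ⟨ht, rfl⟩ := h
    rw [le_div_iff₀ ht]
    linarith

theorem isProbabilityMeasure_privacyNoise (mode : PrivacyMode) (s : ℝ≥0) {φ : ℝ} (hφ : 0 < φ) :
    IsProbabilityMeasure (privacyNoise mode ι s φ) := by
  cases mode with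
  | pureDP =>
    by_cases hs : s = 0
    · simp only [privacyNoise, hs, if_true]
      infer_instance
    · simp only [privacyNoise, hs, if_false]
      have : 0 < (s : ℝ) := by exact_mod_cast pos_iff_ne_zero.2 hs
      exact isProbabilityMeasure_sphericalLaplace (by positivity)
  | zCDP => exact isProbabilityMeasure_isotropicGaussian _

theorem measurable_privacyNoise (mode : PrivacyMode) (φ : ℝ) :
    Measurable fun s => privacyNoise mode ι s φ := by
  cases mode with
  | pureDP =>
    refine Measurable.ite (measurableSet_singleton (0 : ℝ≥0)) measurable_const ?_
    exact measurable_sphericalLaplace.comp (by fun_prop)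
  | zCDP =>
    exact (measurable_isotropicGaussian (ι := ι)).comp (f := fun s : ℝ≥0 => ((s : ℝ) ^ 2 / (2 * φ)).toNNReal)
      (by fun_prop)

/-- The additive noise mechanism with sensitivity `s`. -/
theorem privacyNoise_shift_dominated {mode : PrivacyMode} {t q : ℝ}
    (h : IsPrivacyExponent mode t q) {s : ℝ≥0} {φ : ℝ} (hφ : 0 < φ) {u w : EuclideanSpace ℝ ι}
    (huw : dist u w ≤ s) :
    HolderDominated (ENNReal.ofReal (Real.exp (t * φ))) q
      ((privacyNoise mode ι s φ).map (u + ·)) ((privacyNoise mode ι s φ).map (w + ·)) := by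
  have hprob := isProbabilityMeasure_privacyNoise (ι := ι) mode s hφ
  -- At `s = 0` there is no usable density, but then `u = w` and the two laws coincide.
  rcases eq_or_ne s 0 with rfl | hs
  · obtain rfl : u = w := dist_le_zero.1 huw
    have : IsProbabilityMeasure ((privacyNoise mode ι 0 φ).map (u + ·)) :=
      Measure.isProbabilityMeasure_map (by fun_prop)
    refine (HolderDominated.refl h.one_le _).mono ?_
    have ht : 0 ≤ t := by
      cases mode with
      | pureDP => rw [h.1]; exact zero_le_one
      | zCDP => exact h.1.le
    rw [ENNReal.one_le_ofReal]
    exact Real.one_le_exp (by positivity)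
  have hs' : 0 < (s : ℝ) := by exact_mod_cast pos_iff_ne_zero.2 hs
  cases mode with
  | pureDP =>
    obtain ⟨rfl, rfl⟩ := h
    simp only [privacyNoise, hs, if_false]
    refine (sphericalLaplace_shift_dominated (by positivity) u w).mono ?_
    refine ENNReal.ofReal_le_ofReal (Real.exp_le_exp.2 ?_)
    rw [one_mul, div_mul_eq_mul_div, div_le_iff₀ hs']
    gcongr
  | zCDP =>
    obtain ⟨ht, rfl⟩ := h
    have hpq : (t + 1).HolderConjugate ((t + 1) / t) := by
      have h := Real.HolderConjugate.conjExponent (p := t + 1) (by linarith)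
      rwa [Real.conjExponent, add_sub_cancel_right] at h
    have hv : 0 < (s : ℝ) ^ 2 / (2 * φ) := by positivity
    refine (isotropicGaussian_shift_dominated hpq (by simpa using hv) u w).mono ?_
    refine ENNReal.ofReal_le_ofReal (Real.exp_le_exp.2 ?_)
    rw [Real.coe_toNNReal _ hv.le, add_sub_cancel_right]
    -- The variance `s ^ 2 / (2 φ)` is exactly the one that turns the Gaussian exponent at distance
    -- `s` into `t φ`.
    calc t / (2 * ((s : ℝ) ^ 2 / (2 * φ))) * dist u w ^ 2
        ≤ t / (2 * ((s : ℝ) ^ 2 / (2 * φ))) * (s : ℝ) ^ 2 := by gcongr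
      _ = t * φ := by field_simp

end PrivacyNoise

/-! ### Measurability of matrix operations; privacy of `privSPDMat` -/

section Matrices

open scoped MatrixOrder Topology Matrix

variable {d : ℕ}

instance borelSpace_matrix : BorelSpace (Matrix (Fin d) (Fin d) ℝ) :=
  inferInstanceAs (BorelSpace (Fin d → Fin d → ℝ))

theorem measurable_symmPart : Measurable (symmPart (d := d)) := by
  refine Continuous.measurable ?_
  unfold symmPart
  fun_prop

/-- For a fixed matrix the functional calculus sees only finitely many eigenvalues, so pointwise
convergence of the functions suffices. -/
theorem tendsto_hermitian_cfc {A : Matrix (Fin d) (Fin d) ℝ} (hA : A.IsHermitian)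
    {g : ℕ → ℝ → ℝ} {h : ℝ → ℝ} (hgh : ∀ x, Filter.Tendsto (fun k => g k x) Filter.atTop (𝓝 (h x))) :
    Filter.Tendsto (fun k => cfc (g k) A) Filter.atTop (𝓝 (cfc h A)) := by
  simp_rw [hA.cfc_eq, Matrix.IsHermitian.cfc, Unitary.conjStarAlgAut_apply]
  refine Filter.Tendsto.mul_const _ (Filter.Tendsto.const_mul _ ?_)
  refine (Continuous.matrix_diagonal continuous_id).continuousAt.tendsto.comp ?_
  exact tendsto_pi_nhds.2 fun i => hgh _

theorem exists_polynomial_tendsto {g : ℝ → ℝ} (hg : Continuous g) :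
    ∃ p : ℕ → Polynomial ℝ, ∀ x, Filter.Tendsto (fun k => (p k).eval x) Filter.atTop (𝓝 (g x)) := by
  -- Weierstrass approximation on `[-k, k]` with error `1 / (k + 1)`: every fixed point eventually
  -- lies in these intervals.
  choose p hp using fun k : ℕ => exists_polynomial_near_of_continuousOn (-k) k g hg.continuousOn
    (1 / ((k : ℝ) + 1)) (by positivity)
  refine ⟨p, fun x => ?_⟩
  rw [tendsto_iff_dist_tendsto_zero]
  refine squeeze_zero' (Filter.Eventually.of_forall fun _ => dist_nonneg) ?_
    tendsto_one_div_add_atTop_nhds_zero_nat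
  filter_upwards [Filter.eventually_ge_atTop ⌈|x|⌉₊] with k hk
  have hx : |x| ≤ k := (Nat.le_ceil _).trans (by exact_mod_cast hk)
  exact (hp k x (abs_le.1 hx)).le

/-- The eigenvectors are obtained by choice and need not depend measurably on the matrix. The
functional calculus avoids them: it is a pointwise limit of polynomials in the symmetric part, which
are continuous. -/
theorem measurable_cfc_symmPart {g : ℝ → ℝ} (hg : Continuous g) :
    Measurable fun M : Matrix (Fin d) (Fin d) ℝ => cfc g (symmPart M) := by
  obtain ⟨p, hp⟩ := exists_polynomial_tendsto hg
  have hlim : ∀ M : Matrix (Fin d) (Fin d) ℝ, Filter.Tendsto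
      (fun k => Polynomial.aeval (symmPart M) (p k)) Filter.atTop (𝓝 (cfc g (symmPart M))) := by
    intro M
    have hM : IsSelfAdjoint (symmPart M) := symmPart_isHermitian M
    have h := tendsto_hermitian_cfc (symmPart_isHermitian M) hp
    simpa only [cfc_polynomial _ _ hM] using h
  have hmeas : ∀ k, Measurable fun M : Matrix (Fin d) (Fin d) ℝ =>
      Polynomial.aeval (symmPart M) (p k) := fun k =>
    (Polynomial.continuous_aeval (p k)).measurable.comp measurable_symmPart
  refine measurable_pi_lambda _ fun i => measurable_pi_lambda _ fun j => ?_
  refine measurable_of_tendsto_metrizable (f := fun k M => Polynomial.aeval (symmPart M) (p k) i j)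
    (fun k => (measurable_pi_apply j).comp ((measurable_pi_apply i).comp (hmeas k))) ?_
  exact tendsto_pi_nhds.2 fun M => tendsto_pi_nhds.1 (tendsto_pi_nhds.1 (hlim M) i) j

theorem clipSPD_eq_cfc (c : ℝ) (M : Matrix (Fin d) (Fin d) ℝ) :
    clipSPD c M = cfc (fun x => max x (2 * c)) (symmPart M) := by
  rw [(symmPart_isHermitian M).cfc_eq, Matrix.IsHermitian.cfc, Unitary.conjStarAlgAut_apply]
  rfl

theorem measurable_clipSPD (c : ℝ) : Measurable (clipSPD (d := d) c) := by
  rw [show clipSPD (d := d) c = _ from funext (clipSPD_eq_cfc c)]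
  exact measurable_cfc_symmPart (by fun_prop)

theorem measurableSet_posSemidef :
    MeasurableSet {S : Matrix (Fin d) (Fin d) ℝ | S.PosSemidef} := by
  refine IsClosed.measurableSet ?_
  simp_rw [Matrix.posSemidef_iff_dotProduct_mulVec, Set.ofPred_and, Set.ofPred_forall]
  refine IsClosed.inter ?_ (isClosed_iInter fun x => ?_)
  · exact isClosed_eq (by fun_prop) continuous_id
  · exact isClosed_le continuous_const (by fun_prop)

theorem measurable_matrix_sqrt :
    Measurable fun S : Matrix (Fin d) (Fin d) ℝ => CFC.sqrt S := by
  classical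
  -- `CFC.sqrt` takes the default value 0 off the closed set of positive semidefinite matrices; on
  -- that set `S` equals its symmetric part.
  have h : (fun S : Matrix (Fin d) (Fin d) ℝ => CFC.sqrt S) =
      fun S => if S.PosSemidef then cfc Real.sqrt (symmPart S) else 0 := by
    ext1 S
    split_ifs with hS
    · have hS' : symmPart S = S := by
        have : S.transpose = S := hS.isHermitian
        rw [symmPart, this, ← two_smul ℝ S, smul_smul]
        norm_num
      rw [hS', CFC.sqrt_eq_real_sqrt S hS.nonneg, cfcₙ_eq_cfc]
    · exact CFC.sqrt_of_not_nonneg fun h => hS (Matrix.nonneg_iff_posSemidef.1 h)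
  rw [h]
  exact Measurable.ite measurableSet_posSemidef (measurable_cfc_symmPart Real.continuous_sqrt)
    measurable_const

theorem measurable_matrix_apply (i j : Fin d) :
    Measurable fun M : Matrix (Fin d) (Fin d) ℝ => M i j :=
  (measurable_pi_apply j).comp (measurable_pi_apply i)

theorem measurable_mulVec_toLp : Measurable fun p : Matrix (Fin d) (Fin d) ℝ ×
    EuclideanSpace ℝ (Fin d) => (WithLp.toLp 2 (p.1.mulVec p.2) : EuclideanSpace ℝ (Fin d)) := by
  refine (WithLp.measurable_toLp 2 _).comp (measurable_pi_lambda _ fun i => ?_)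
  simp only [Matrix.mulVec, dotProduct]
  refine Finset.measurable_sum _ fun j _ => ?_
  exact ((measurable_matrix_apply i j).comp measurable_fst).mul (by fun_prop)

/-- Adjugate formula; at singular matrices the convention `0⁻¹ = 0` agrees with the default value of
the matrix inverse. -/
theorem measurable_matrix_inv : Measurable fun M : Matrix (Fin d) (Fin d) ℝ => M⁻¹ := by
  simp_rw [Matrix.inv_def, Ring.inverse_eq_inv']
  have h1 : Measurable fun M : Matrix (Fin d) (Fin d) ℝ => M.det⁻¹ :=
    (Continuous.measurable (by fun_prop)).inv
  have h2 : Measurable fun M : Matrix (Fin d) (Fin d) ℝ => M.adjugate :=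
    Continuous.measurable (by fun_prop)
  refine measurable_pi_lambda _ fun i => measurable_pi_lambda _ fun j => ?_
  exact h1.mul ((measurable_matrix_apply i j).comp h2)

/-- Each law is the image of a fixed product of standard Gaussians under multiplication by `CFC.sqrt
S`, which is jointly measurable in `S` and the sample. -/
theorem measurable_pi_multivariateGaussian (m : ℕ) :
    Measurable fun S : Matrix (Fin d) (Fin d) ℝ =>
      Measure.pi fun _ : Fin m => multivariateGaussian 0 S := by
  have h : ∀ S : Matrix (Fin d) (Fin d) ℝ,
      (Measure.pi fun _ : Fin m => multivariateGaussian 0 S) =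
      (Measure.pi fun _ : Fin m => stdGaussian (EuclideanSpace ℝ (Fin d))).map
        fun z i => WithLp.toLp 2 ((CFC.sqrt S).mulVec (z i)) := by
    intro S
    have hS : multivariateGaussian 0 S = (stdGaussian (EuclideanSpace ℝ (Fin d))).map
        fun z : EuclideanSpace ℝ (Fin d) => WithLp.toLp 2 ((CFC.sqrt S).mulVec z) := by
      rw [multivariateGaussian]
      congr 1
      ext1 z
      rw [zero_add]
      exact Matrix.toEuclideanCLM_toLp _ _
    have hm : Measurable fun z : EuclideanSpace ℝ (Fin d) =>
        (WithLp.toLp 2 ((CFC.sqrt S).mulVec z) : EuclideanSpace ℝ (Fin d)) :=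
      measurable_mulVec_toLp.comp measurable_prodMk_left
    have : IsProbabilityMeasure ((stdGaussian (EuclideanSpace ℝ (Fin d))).map
        fun z : EuclideanSpace ℝ (Fin d) =>
          (WithLp.toLp 2 ((CFC.sqrt S).mulVec z) : EuclideanSpace ℝ (Fin d))) :=
      Measure.isProbabilityMeasure_map hm.aemeasurable
    rw [Measure.pi_map_pi (f := fun _ (z : EuclideanSpace ℝ (Fin d)) =>
      (WithLp.toLp 2 ((CFC.sqrt S).mulVec z) : EuclideanSpace ℝ (Fin d)))
      fun _ => hm.aemeasurable, hS]
  simp_rw [h]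
  refine measurable_parametrized_map measurable_const (measurable_pi_lambda _ fun i => ?_)
  exact measurable_mulVec_toLp.comp ((measurable_matrix_sqrt.comp measurable_fst).prodMk
    ((measurable_pi_apply i).comp measurable_snd))

theorem measurable_toMat : Measurable (toMat (d := d)) := by
  refine measurable_pi_lambda _ fun i => measurable_pi_lambda _ fun j => ?_
  simp only [toMat, Matrix.of_apply]
  fun_prop

theorem measurable_toVec : Measurable (toVec (d := d)) :=
  (WithLp.measurable_toLp 2 _).comp
    (measurable_pi_lambda _ fun p => measurable_matrix_apply p.1 p.2)

theorem toMat_toVec_add (M : Matrix (Fin d) (Fin d) ℝ) (η : EuclideanSpace ℝ (Fin d × Fin d)) :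
    toMat (toVec M + η) = M + toMat η := by
  ext i j
  simp [toMat, toVec]

/-- Separates the noisy vector of entries from a map that does not involve the data, so that matrix
privacy becomes post-processing of the vector mechanism. -/
theorem privSPDMat_eq_map (mode : PrivacyMode) (M : Matrix (Fin d) (Fin d) ℝ) (s : ℝ≥0)
    (φ c : ℝ) : privSPDMat mode M s φ c =
      ((privacyNoise mode (Fin d × Fin d) s φ).map (toVec M + ·)).map
        (clipSPD c ∘ toMat) := by
  rw [Measure.map_map ((measurable_clipSPD c).comp measurable_toMat) (by fun_prop), privSPDMat]
  congr 1

theorem isProbabilityMeasure_privSPDMat (mode : PrivacyMode) (M : Matrix (Fin d) (Fin d) ℝ)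
    (s : ℝ≥0) {φ : ℝ} (hφ : 0 < φ) (c : ℝ) : IsProbabilityMeasure (privSPDMat mode M s φ c) := by
  have := isProbabilityMeasure_privacyNoise (ι := Fin d × Fin d) mode s hφ
  rw [privSPDMat_eq_map]
  have := Measure.isProbabilityMeasure_map (μ := privacyNoise mode (Fin d × Fin d) s φ)
    (f := (toVec M + ·)) (by fun_prop)
  exact Measure.isProbabilityMeasure_map
    ((measurable_clipSPD c).comp measurable_toMat).aemeasurable

theorem measurable_privSPDMat {Ω : Type*} [MeasurableSpace Ω] (mode : PrivacyMode)
    {M : Ω → Matrix (Fin d) (Fin d) ℝ} (hM : Measurable M) {s : Ω → ℝ≥0} (hs : Measurable s)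
    {φ : ℝ} (hφ : 0 < φ) (c : ℝ) : Measurable fun ω => privSPDMat mode (M ω) (s ω) φ c := by
  have := fun ω => isProbabilityMeasure_privacyNoise (ι := Fin d × Fin d) mode (s ω) hφ
  refine measurable_parametrized_map (κ := fun ω => privacyNoise mode (Fin d × Fin d) (s ω) φ)
    ((measurable_privacyNoise mode φ).comp hs)
    (g := fun ω η => clipSPD c (M ω + toMat η)) ((measurable_clipSPD c).comp ?_)
  simp_rw [← toMat_toVec_add]
  refine measurable_toMat.comp ?_
  exact (measurable_toVec.comp (hM.comp measurable_fst)).add measurable_snd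

theorem privSPDMat_dominated {mode : PrivacyMode} {t q : ℝ} (h : IsPrivacyExponent mode t q)
    {M M' : Matrix (Fin d) (Fin d) ℝ} {s : ℝ≥0} (hs : edist (toVec M) (toVec M') ≤ s) {φ : ℝ}
    (hφ : 0 < φ) (c : ℝ) :
    HolderDominated (ENNReal.ofReal (Real.exp (t * φ))) q
      (privSPDMat mode M s φ c) (privSPDMat mode M' s φ c) := by
  rw [privSPDMat_eq_map, privSPDMat_eq_map]
  refine (privacyNoise_shift_dominated h hφ ?_).map
    ((measurable_clipSPD c).comp measurable_toMat)
  rw [dist_nndist]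
  rw [edist_nndist] at hs
  exact_mod_cast hs

end Matrices

/-! ### Existence and sensitivity of the empirical risk minimizer -/

section ERM

variable {n d : ℕ} {f : ℝ → ℝ}

theorem abs_sub_le_of_deriv (hf : Differentiable ℝ f) (hf' : ∀ z, |deriv f z| ≤ 1) (x y : ℝ) :
    |f x - f y| ≤ |x - y| := by
  simpa using Convex.norm_image_sub_le_of_norm_deriv_le (f := f) (s := Set.univ) (C := 1)
    (fun z _ => hf z) (fun z _ => hf' z) convex_univ (Set.mem_univ y) (Set.mem_univ x)

theorem abs_loss_sub_le (hf : Differentiable ℝ f) (hf' : ∀ z, |deriv f z| ≤ 1) (r : Record d)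
    (θ θ' : EuclideanSpace ℝ (Fin d)) : |loss f r θ - loss f r θ'| ≤ ‖θ - θ'‖ := by
  refine (abs_sub_le_of_deriv hf hf' _ _).trans ?_
  have hy : |r.y| = 1 := by rcases r.y_mem with h | h <;> simp [h]
  rw [← mul_sub, ← inner_sub_left, abs_mul, hy, one_mul]
  simpa [r.norm_x] using abs_real_inner_le_norm (θ - θ') r.x

theorem continuous_loss (hf : Differentiable ℝ f) (r : Record d) : Continuous (loss f r) := by
  have := hf.continuous
  unfold loss
  fun_prop

theorem loss_convex (hf : ConvexOn ℝ Set.univ f) (r : Record d)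
    (θ θ' : EuclideanSpace ℝ (Fin d)) {t : ℝ} (ht0 : 0 ≤ t) (ht1 : t ≤ 1) :
    loss f r ((1 - t) • θ + t • θ') ≤ (1 - t) * loss f r θ + t * loss f r θ' := by
  have h := hf.2 (Set.mem_univ (r.y * inner ℝ θ r.x)) (Set.mem_univ (r.y * inner ℝ θ' r.x))
    (sub_nonneg.2 ht1) ht0 (by ring)
  simp only [smul_eq_mul] at h
  have he : r.y * inner ℝ ((1 - t) • θ + t • θ') r.x =
      (1 - t) * (r.y * inner ℝ θ r.x) + t * (r.y * inner ℝ θ' r.x) := by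
    rw [inner_add_left, real_inner_smul_left, real_inner_smul_left]
    ring
  rw [loss, he]
  exact h

theorem empiricalRisk_eq (hn : 0 < n) (f : ℝ → ℝ) (c : ℝ) (D : Database n d)
    (θ : EuclideanSpace ℝ (Fin d)) :
    empiricalRisk f c D θ = (1 / (n : ℝ)) * ∑ i, loss f (D i) θ + c * ‖θ‖ ^ 2 := by
  have : (n : ℝ) ≠ 0 := by exact_mod_cast hn.ne'
  rw [empiricalRisk, Finset.sum_add_distrib, Finset.sum_const, Finset.card_univ, Fintype.card_fin,
    nsmul_eq_mul]
  field_simp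

/-- The losses decrease at most linearly, so the quadratic penalty makes the continuous risk
coercive. This is what gives the `Classical.epsilon` in `erm` its meaning. -/
theorem exists_isMinOn_empiricalRisk (hn : 0 < n) (hf : Differentiable ℝ f)
    (hf' : ∀ z, |deriv f z| ≤ 1) {c : ℝ} (hc : 0 < c) (D : Database n d) :
    ∃ θ, IsMinOn (empiricalRisk f c D) Set.univ θ := by
  have hn' : (0 : ℝ) < n := by exact_mod_cast hn
  have hcont : Continuous (empiricalRisk f c D) := by
    have := fun i => continuous_loss hf (D i)
    unfold empiricalRisk
    fun_prop
  have hlow : ∀ θ : EuclideanSpace ℝ (Fin d),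
      f 0 + ‖θ‖ * (c * ‖θ‖ - 1) ≤ empiricalRisk f c D θ := by
    intro θ
    rw [empiricalRisk_eq hn]
    have h1 : ∀ i, f 0 - ‖θ‖ ≤ loss f (D i) θ := fun i => by
      have h2 := abs_loss_sub_le hf hf' (D i) θ 0
      rw [sub_zero] at h2
      have h3 : loss f (D i) 0 = f 0 := by simp [loss]
      rw [h3] at h2
      linarith [(abs_le.1 h2).1]
    have h4 : n * (f 0 - ‖θ‖) ≤ ∑ i, loss f (D i) θ := by
      simpa using Finset.card_nsmul_le_sum Finset.univ _ _ fun i _ => h1 i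
    have h5 : f 0 - ‖θ‖ ≤ (1 / (n : ℝ)) * ∑ i, loss f (D i) θ := by
      rw [one_div, inv_mul_eq_div, le_div_iff₀ hn']
      linarith
    nlinarith
  have htend : Filter.Tendsto (empiricalRisk f c D) (Filter.cocompact _) Filter.atTop := by
    refine Filter.tendsto_atTop_mono hlow (Filter.tendsto_atTop_add_const_left _ _ ?_)
    have h := tendsto_norm_cocompact_atTop (E := EuclideanSpace ℝ (Fin d))
    exact h.atTop_mul_atTop₀ (Filter.tendsto_atTop_add_const_right _ _
      (h.const_mul_atTop hc))
  obtain ⟨θ, hθ⟩ := hcont.exists_forall_le htend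
  exact ⟨θ, fun θ' _ => hθ θ'⟩

theorem norm_convex_combination_sq {E : Type*} [NormedAddCommGroup E] [InnerProductSpace ℝ E]
    (x y : E) (t : ℝ) : ‖(1 - t) • x + t • y‖ ^ 2 =
      (1 - t) * ‖x‖ ^ 2 + t * ‖y‖ ^ 2 - t * (1 - t) * ‖y - x‖ ^ 2 := by
  rw [norm_add_sq_real, norm_sub_sq_real, norm_smul, norm_smul, real_inner_smul_left,
    real_inner_smul_right, mul_pow, mul_pow, Real.norm_eq_abs, Real.norm_eq_abs, sq_abs, sq_abs,
    real_inner_comm]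
  ring

/-- Quadratic growth of the regularized risk around a minimizer. -/
theorem empiricalRisk_quadratic_growth (hn : 0 < n) (hf : ConvexOn ℝ Set.univ f) (c : ℝ)
    (D : Database n d) {θ₀ : EuclideanSpace ℝ (Fin d)}
    (h₀ : IsMinOn (empiricalRisk f c D) Set.univ θ₀) (θ : EuclideanSpace ℝ (Fin d)) :
    empiricalRisk f c D θ₀ + c * ‖θ - θ₀‖ ^ 2 ≤ empiricalRisk f c D θ := by
  have hconv : ∀ t : ℝ, 0 ≤ t → t ≤ 1 → empiricalRisk f c D ((1 - t) • θ₀ + t • θ) ≤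
      (1 - t) * empiricalRisk f c D θ₀ + t * empiricalRisk f c D θ -
        c * (t * (1 - t) * ‖θ - θ₀‖ ^ 2) := by
    intro t ht0 ht1
    rw [empiricalRisk_eq hn, empiricalRisk_eq hn, empiricalRisk_eq hn,
      norm_convex_combination_sq]
    have h1 : ∑ i, loss f (D i) ((1 - t) • θ₀ + t • θ) ≤
        (1 - t) * ∑ i, loss f (D i) θ₀ + t * ∑ i, loss f (D i) θ := by
      rw [Finset.mul_sum, Finset.mul_sum, ← Finset.sum_add_distrib]
      exact Finset.sum_le_sum fun i _ => loss_convex hf (D i) θ₀ θ ht0 ht1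
    have h2 := mul_le_mul_of_nonneg_left h1 (show (0 : ℝ) ≤ 1 / n by positivity)
    linarith
  -- Comparing `θ₀` with a point at fraction `t` of the segment and dividing by `t` leaves a factor
  -- `1 - t` on the quadratic term; letting `t` tend to 0 from the right recovers the full constant
  -- `c`.
  have hlim : Filter.Tendsto (fun t : ℝ => empiricalRisk f c D θ₀ + c * ((1 - t) * ‖θ - θ₀‖ ^ 2))
      (nhdsWithin 0 (Set.Ioi 0)) (nhds (empiricalRisk f c D θ₀ + c * ‖θ - θ₀‖ ^ 2)) := by
    have hcont : Continuous fun t : ℝ =>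
      empiricalRisk f c D θ₀ + c * ((1 - t) * ‖θ - θ₀‖ ^ 2) := by fun_prop
    simpa using (hcont.tendsto 0).mono_left nhdsWithin_le_nhds
  refine le_of_tendsto hlim ?_
  filter_upwards [Ioo_mem_nhdsGT (zero_lt_one (α := ℝ))] with t ht
  have h1 := hconv t ht.1.le ht.2.le
  have h2 : empiricalRisk f c D θ₀ ≤ empiricalRisk f c D ((1 - t) • θ₀ + t • θ) :=
    h₀ (Set.mem_univ _)
  have h3 : 0 ≤ t * (empiricalRisk f c D θ -
      (empiricalRisk f c D θ₀ + c * ((1 - t) * ‖θ - θ₀‖ ^ 2))) := by linarith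
  exact sub_nonneg.1 (nonneg_of_mul_nonneg_right h3 ht.1)

/-- The empirical risk minimizer has sensitivity `1 / (n c)`. -/
theorem dist_erm_le (hn : 0 < n) (hf_convex : ConvexOn ℝ Set.univ f) (hf : Differentiable ℝ f)
    (hf' : ∀ z, |deriv f z| ≤ 1) {c : ℝ} (hc : 0 < c) {D D' : Database n d}
    (hD : Neighbor D D') : dist (erm f c D) (erm f c D') ≤ 1 / (n * c) := by
  have hn' : (0 : ℝ) < n := by exact_mod_cast hn
  have h1 : IsMinOn (empiricalRisk f c D) Set.univ (erm f c D) :=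
    Classical.epsilon_spec (exists_isMinOn_empiricalRisk hn hf hf' hc D)
  have h2 : IsMinOn (empiricalRisk f c D') Set.univ (erm f c D') :=
    Classical.epsilon_spec (exists_isMinOn_empiricalRisk hn hf hf' hc D')
  set θ := erm f c D
  set θ' := erm f c D'
  have g1 := empiricalRisk_quadratic_growth hn hf_convex c D h1 θ'
  have g2 := empiricalRisk_quadratic_growth hn hf_convex c D' h2 θ
  obtain ⟨i, hi⟩ := hD
  have hsum : ∀ ϑ, ∑ j, loss f (D j) ϑ - ∑ j, loss f (D' j) ϑ =
      loss f (D i) ϑ - loss f (D' i) ϑ := by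
    intro ϑ
    rw [← Finset.sum_sub_distrib]
    refine Finset.sum_eq_single i (fun j _ hj => ?_) (fun h => absurd (Finset.mem_univ i) h)
    rw [hi j hj, sub_self]
  have l1 := abs_le.1 (abs_loss_sub_le hf hf' (D i) θ' θ)
  have l2 := abs_le.1 (abs_loss_sub_le hf hf' (D' i) θ' θ)
  rw [norm_sub_rev θ θ'] at g2
  rw [dist_comm, dist_eq_norm]
  set δ := ‖θ' - θ‖
  have hδ : 0 ≤ δ := norm_nonneg _
  simp_rw [empiricalRisk_eq hn] at g1 g2
  -- Add the two growth inequalities, each evaluated at the other minimizer. The penalties cancel,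
  -- only the losses of record `i` survive, and each of these two losses changes by at most `δ`.
  have key : 2 * c * δ ^ 2 ≤ (1 / (n : ℝ)) * (2 * δ) := by
    have e1 := hsum θ
    have e2 := hsum θ'
    calc 2 * c * δ ^ 2 ≤ (1 / (n : ℝ)) * ((∑ j, loss f (D j) θ' - ∑ j, loss f (D' j) θ') -
          (∑ j, loss f (D j) θ - ∑ j, loss f (D' j) θ)) := by linarith
      _ ≤ (1 / (n : ℝ)) * (2 * δ) := by
          rw [e1, e2]
          gcongr
          linarith [l1.1, l1.2, l2.1, l2.2]
  rcases hδ.eq_or_lt with h0 | h0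
  · rw [← h0]
    positivity
  · rw [le_div_iff₀ (by positivity)]
    have h3 : 2 * c * δ ^ 2 * n ≤ 2 * δ := by
      calc 2 * c * δ ^ 2 * n ≤ (1 / (n : ℝ)) * (2 * δ) * n := by gcongr
        _ = 2 * δ := by field_simp
    have h4 : (2 * δ) * (δ * (n * c)) ≤ (2 * δ) * 1 := by linarith
    exact le_of_mul_le_mul_left h4 (by positivity)

end ERM

/-! ### The stages of the algorithm and their composition -/

section Algorithm

variable {n d m : ℕ}

theorem isProbabilityMeasure_outputNoise (mode : PrivacyMode) (n d : ℕ) (c : ℝ) {φ : ℝ}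
    (hφ : 0 < φ) : IsProbabilityMeasure (outputNoise mode n d c φ) :=
  isProbabilityMeasure_privacyNoise mode _ hφ

theorem isProbabilityMeasure_outputPerturb (mode : PrivacyMode) (f : ℝ → ℝ) (c : ℝ) {φ : ℝ}
    (hφ : 0 < φ) (D : Database n d) : IsProbabilityMeasure (outputPerturb mode f c φ D) := by
  have := isProbabilityMeasure_outputNoise mode n d c hφ
  exact Measure.isProbabilityMeasure_map (by fun_prop)

theorem outputPerturb_dominated {mode : PrivacyMode} {t q : ℝ} (h : IsPrivacyExponent mode t q)
    (hn : 0 < n) {f : ℝ → ℝ} (hf_convex : ConvexOn ℝ Set.univ f) (hf : Differentiable ℝ f)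
    (hf' : ∀ z, |deriv f z| ≤ 1) {c φ : ℝ} (hc : 0 < c) (hφ : 0 < φ) {D D' : Database n d}
    (hD : Neighbor D D') :
    HolderDominated (ENNReal.ofReal (Real.exp (t * φ))) q
      (outputPerturb mode f c φ D) (outputPerturb mode f c φ D') := by
  refine privacyNoise_shift_dominated h hφ ?_
  rw [Real.coe_toNNReal _ (by positivity)]
  exact dist_erm_le hn hf_convex hf hf' hc hD

theorem measurable_riskHessian {f : ℝ → ℝ}
    {hess : Record d → EuclideanSpace ℝ (Fin d) → Matrix (Fin d) (Fin d) ℝ}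
    (hhess : IsLossHessian f hess) (c : ℝ) (D : Database n d) :
    Measurable fun θ => riskHessian hess c θ D := by
  refine measurable_pi_lambda _ fun j => measurable_pi_lambda _ fun k => ?_
  simp only [riskHessian, Matrix.add_apply, Matrix.smul_apply, Matrix.sum_apply, smul_eq_mul]
  refine Measurable.add_const (Measurable.const_mul (Finset.measurable_sum _ fun i _ => ?_) _) _
  exact (measurable_matrix_apply j k).comp (hhess.measurable (D i))

theorem measurable_gradCovariance (f : ℝ → ℝ) (c : ℝ) (D : Database n d) :
    Measurable fun θ => gradCovariance f c θ D := by
  have hgrad : ∀ i, Measurable fun θ => gradient (loss f (D i)) θ := fun i =>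
    (InnerProductSpace.toDual ℝ (EuclideanSpace ℝ (Fin d))).symm.continuous.measurable.comp
      (measurable_fderiv ℝ (loss f (D i)))
  refine measurable_pi_lambda _ fun j => measurable_pi_lambda _ fun k => ?_
  simp only [gradCovariance, Matrix.sub_apply, Matrix.smul_apply, Matrix.sum_apply,
    Matrix.of_apply, smul_eq_mul]
  fun_prop

theorem measurable_intervals {ci : (Fin m → ℝ) → ℝ × ℝ} (hci : Measurable ci) :
    Measurable (intervals (d := d) ci) := by
  have h : ∀ j : Fin d, Measurable fun θs : Fin m → EuclideanSpace ℝ (Fin d) =>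
      ci fun i => θs i j := fun j => hci.comp (by fun_prop)
  exact ((WithLp.measurable_toLp 2 _).comp (measurable_pi_lambda _ fun j => (h j).fst)).prodMk
    ((WithLp.measurable_toLp 2 _).comp (measurable_pi_lambda _ fun j => (h j).snd))

/-- The data-independent last stage: the law of the confidence intervals computed from released
values of the parameter, the Hessian and the covariance matrix. -/
def intervalLaw (mode : PrivacyMode) (n : ℕ) (c φ : ℝ) (ci : (Fin m → ℝ) → ℝ × ℝ)
    (p : (EuclideanSpace ℝ (Fin d) × Matrix (Fin d) (Fin d) ℝ) × Matrix (Fin d) (Fin d) ℝ) :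
    Measure (EuclideanSpace ℝ (Fin d) × EuclideanSpace ℝ (Fin d)) :=
  (Measure.pi fun _ : Fin m => multivariateGaussian 0 p.2).bind fun G =>
  (Measure.pi fun _ : Fin m => outputNoise mode n d c φ).map fun β =>
    intervals ci (fun i => paramSample n p.1.1 p.1.2 (G i) (β i))

theorem measurable_intervals_paramSample (n : ℕ) {ci : (Fin m → ℝ) → ℝ × ℝ}
    (hci : Measurable ci) :
    Measurable fun p : (((EuclideanSpace ℝ (Fin d) × Matrix (Fin d) (Fin d) ℝ) ×
        Matrix (Fin d) (Fin d) ℝ) × (Fin m → EuclideanSpace ℝ (Fin d))) ×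
        (Fin m → EuclideanSpace ℝ (Fin d)) =>
      intervals ci (fun i => paramSample n p.1.1.1.1 p.1.1.1.2 (p.1.2 i) (p.2 i)) := by
  refine (measurable_intervals hci).comp (measurable_pi_lambda _ fun i => ?_)
  refine Measurable.sub (Measurable.add (by fun_prop) (Measurable.fun_const_smul ?_ _)) (by fun_prop)
  exact measurable_mulVec_toLp.comp ((measurable_matrix_inv.comp (by fun_prop)).prodMk
    (by fun_prop))

theorem measurable_intervalLaw_kernel (mode : PrivacyMode) (n : ℕ) (c : ℝ) {φ : ℝ} (hφ : 0 < φ)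
    {ci : (Fin m → ℝ) → ℝ × ℝ} (hci : Measurable ci) :
    Measurable (Function.uncurry fun
      (p : (EuclideanSpace ℝ (Fin d) × Matrix (Fin d) (Fin d) ℝ) × Matrix (Fin d) (Fin d) ℝ)
      (G : Fin m → EuclideanSpace ℝ (Fin d)) =>
      (Measure.pi fun _ : Fin m => outputNoise mode n d c φ).map fun β =>
        intervals ci (fun i => paramSample n p.1.1 p.1.2 (G i) (β i))) := by
  have := isProbabilityMeasure_outputNoise mode n d c hφ
  exact measurable_parametrized_map measurable_const (measurable_intervals_paramSample n hci)

theorem measurable_intervalLaw (mode : PrivacyMode) (n : ℕ) (c : ℝ) {φ : ℝ} (hφ : 0 < φ)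
    {ci : (Fin m → ℝ) → ℝ × ℝ} (hci : Measurable ci) :
    Measurable (intervalLaw (d := d) mode n c φ ci) :=
  measurable_parametrized_bind
    (κ := fun p : (EuclideanSpace ℝ (Fin d) × Matrix (Fin d) (Fin d) ℝ) ×
      Matrix (Fin d) (Fin d) ℝ => Measure.pi fun _ : Fin m => multivariateGaussian 0 p.2)
    ((measurable_pi_multivariateGaussian m).comp measurable_snd)
    (measurable_intervalLaw_kernel mode n c hφ hci)

theorem isProbabilityMeasure_intervalLaw (mode : PrivacyMode) (n : ℕ) (c : ℝ) {φ : ℝ}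
    (hφ : 0 < φ) {ci : (Fin m → ℝ) → ℝ × ℝ} (hci : Measurable ci)
    (p : (EuclideanSpace ℝ (Fin d) × Matrix (Fin d) (Fin d) ℝ) × Matrix (Fin d) (Fin d) ℝ) :
    IsProbabilityMeasure (intervalLaw mode n c φ ci p) := by
  have := isProbabilityMeasure_outputNoise mode n d c hφ
  have : ∀ G : Fin m → EuclideanSpace ℝ (Fin d), IsProbabilityMeasure
      ((Measure.pi fun _ : Fin m => outputNoise mode n d c φ).map fun β =>
        intervals ci (fun i => paramSample n p.1.1 p.1.2 (G i) (β i))) := fun G =>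
    Measure.isProbabilityMeasure_map
      ((measurable_intervals_paramSample n hci).comp
        (measurable_prodMk_left (x := (p, G)))).aemeasurable
  exact isProbabilityMeasure_bind
    ((measurable_intervalLaw_kernel mode n c hφ hci).comp measurable_prodMk_left)

variable {f : ℝ → ℝ} {c φ₁ φ₂ φ₃ : ℝ}
  {hess : Record d → EuclideanSpace ℝ (Fin d) → Matrix (Fin d) (Fin d) ℝ}
  {sensH sensS : EuclideanSpace ℝ (Fin d) → ℝ≥0} {ci : (Fin m → ℝ) → ℝ × ℝ}

/-- The law of the output given the released parameter and Hessian. -/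
def covarianceStage (mode : PrivacyMode) (f : ℝ → ℝ) (sensS : EuclideanSpace ℝ (Fin d) → ℝ≥0)
    (c φ₁ φ₃ : ℝ) (ci : (Fin m → ℝ) → ℝ × ℝ) (D : Database n d)
    (p : EuclideanSpace ℝ (Fin d) × Matrix (Fin d) (Fin d) ℝ) :
    Measure (EuclideanSpace ℝ (Fin d) × EuclideanSpace ℝ (Fin d)) :=
  (privSPDMat mode (gradCovariance f c p.1 D) (sensS p.1) φ₃ c).bind fun S =>
    intervalLaw mode n c φ₁ ci (p, S)

/-- The law of the output given the released parameter. -/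
def hessianStage (mode : PrivacyMode) (f : ℝ → ℝ)
    (hess : Record d → EuclideanSpace ℝ (Fin d) → Matrix (Fin d) (Fin d) ℝ)
    (sensH sensS : EuclideanSpace ℝ (Fin d) → ℝ≥0) (c φ₁ φ₂ φ₃ : ℝ)
    (ci : (Fin m → ℝ) → ℝ × ℝ) (D : Database n d) (θ : EuclideanSpace ℝ (Fin d)) :
    Measure (EuclideanSpace ℝ (Fin d) × EuclideanSpace ℝ (Fin d)) :=
  (privSPDMat mode (riskHessian hess c θ D) (sensH θ) φ₂ c).bind fun H =>
    covarianceStage mode f sensS c φ₁ φ₃ ci D (θ, H)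

theorem ciOutput_eq_bind (mode : PrivacyMode) (D : Database n d) :
    ciOutput mode f hess sensH sensS c φ₁ φ₂ φ₃ m ci D =
      (outputPerturb mode f c φ₁ D).bind
        (hessianStage mode f hess sensH sensS c φ₁ φ₂ φ₃ ci D) :=
  rfl

theorem measurable_covarianceStage (mode : PrivacyMode) (hφ₁ : 0 < φ₁) (hφ₃ : 0 < φ₃)
    (hsensS : Measurable sensS) (hci : Measurable ci) (D : Database n d) :
    Measurable (covarianceStage mode f sensS c φ₁ φ₃ ci D) := by
  have := fun p : EuclideanSpace ℝ (Fin d) × Matrix (Fin d) (Fin d) ℝ =>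
    isProbabilityMeasure_privSPDMat mode (gradCovariance f c p.1 D) (sensS p.1) hφ₃ c
  exact measurable_parametrized_bind
    (κ := fun p : EuclideanSpace ℝ (Fin d) × Matrix (Fin d) (Fin d) ℝ =>
      privSPDMat mode (gradCovariance f c p.1 D) (sensS p.1) φ₃ c)
    (measurable_privSPDMat mode ((measurable_gradCovariance f c D).comp measurable_fst)
      (hsensS.comp measurable_fst) hφ₃ c)
    (measurable_intervalLaw mode n c hφ₁ hci)

theorem measurable_hessianStage (mode : PrivacyMode) (hφ₁ : 0 < φ₁) (hφ₂ : 0 < φ₂)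
    (hφ₃ : 0 < φ₃) (hhess : IsLossHessian f hess) (hsensH : Measurable sensH)
    (hsensS : Measurable sensS) (hci : Measurable ci) (D : Database n d) :
    Measurable (hessianStage mode f hess sensH sensS c φ₁ φ₂ φ₃ ci D) := by
  have := fun θ => isProbabilityMeasure_privSPDMat mode (riskHessian hess c θ D) (sensH θ) hφ₂ c
  exact measurable_parametrized_bind
    (measurable_privSPDMat mode (measurable_riskHessian hhess c D) hsensH hφ₂ c)
    (measurable_covarianceStage mode hφ₁ hφ₃ hsensS hci D)

theorem isProbabilityMeasure_ciOutput (mode : PrivacyMode) (hφ₁ : 0 < φ₁) (hφ₂ : 0 < φ₂)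
    (hφ₃ : 0 < φ₃) (hhess : IsLossHessian f hess) (hsensH : Measurable sensH)
    (hsensS : Measurable sensS) (hci : Measurable ci) (D : Database n d) :
    IsProbabilityMeasure (ciOutput mode f hess sensH sensS c φ₁ φ₂ φ₃ m ci D) := by
  have := isProbabilityMeasure_outputPerturb mode f c hφ₁ D
  have := isProbabilityMeasure_intervalLaw (d := d) mode n c hφ₁ hci
  have : ∀ p, IsProbabilityMeasure (covarianceStage mode f sensS c φ₁ φ₃ ci D p) := fun p => by
    have := isProbabilityMeasure_privSPDMat mode (gradCovariance f c p.1 D) (sensS p.1) hφ₃ c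
    exact isProbabilityMeasure_bind
      ((measurable_intervalLaw mode n c hφ₁ hci).comp measurable_prodMk_left)
  have : ∀ θ, IsProbabilityMeasure
      (hessianStage mode f hess sensH sensS c φ₁ φ₂ φ₃ ci D θ) := fun θ => by
    have := isProbabilityMeasure_privSPDMat mode (riskHessian hess c θ D) (sensH θ) hφ₂ c
    exact isProbabilityMeasure_bind
      ((measurable_covarianceStage mode hφ₁ hφ₃ hsensS hci D).comp measurable_prodMk_left)
  rw [ciOutput_eq_bind]
  exact isProbabilityMeasure_bind
    (measurable_hessianStage mode hφ₁ hφ₂ hφ₃ hhess hsensH hsensS hci D)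

theorem edist_le_l2Sensitivity {ι : Type*} [Fintype ι]
    (g : Database n d → EuclideanSpace ℝ ι) {D D' : Database n d} (hD : Neighbor D D') :
    edist (g D) (g D') ≤ l2Sensitivity g :=
  le_iSup₂_of_le D D' (le_iSup_of_le hD le_rfl)

/-- Composition from the innermost stage outwards. Each inner bound holds for every fixed value
released earlier, which is why the sensitivity hypotheses are required at all `θ`. The interval
stage is the same kernel for `D` and `D'`, hence its factor 1. -/
theorem ciOutput_dominated {mode : PrivacyMode} {t q : ℝ} (h : IsPrivacyExponent mode t q)
    (hn : 0 < n) (hf_convex : ConvexOn ℝ Set.univ f) (hf_diff : Differentiable ℝ f)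
    (hf_deriv : ∀ z, |deriv f z| ≤ 1)
    (hc : 0 < c) (hφ₁ : 0 < φ₁) (hφ₂ : 0 < φ₂) (hφ₃ : 0 < φ₃)
    (hhess : IsLossHessian f hess) (hsensH_meas : Measurable sensH)
    (hsensS_meas : Measurable sensS)
    (hsensH : ∀ θ, l2Sensitivity
      (fun D : Database n d => toVec (riskHessian hess c θ D)) ≤ sensH θ)
    (hsensS : ∀ θ, l2Sensitivity
      (fun D : Database n d => toVec (gradCovariance f c θ D)) ≤ sensS θ)
    (hci : Measurable ci) {D D' : Database n d} (hD : Neighbor D D') :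
    HolderDominated (ENNReal.ofReal (Real.exp (t * (φ₁ + φ₂ + φ₃)))) q
      (ciOutput mode f hess sensH sensS c φ₁ φ₂ φ₃ m ci D)
      (ciOutput mode f hess sensH sensS c φ₁ φ₂ φ₃ m ci D') := by
  have hq := h.one_le
  have := isProbabilityMeasure_intervalLaw (d := d) mode n c hφ₁ hci
  have hlaw := measurable_intervalLaw (d := d) mode n c hφ₁ hci
  have hS : ∀ θ, edist (toVec (gradCovariance f c θ D)) (toVec (gradCovariance f c θ D')) ≤
      sensS θ := fun θ => (edist_le_l2Sensitivity
        (fun D : Database n d => toVec (gradCovariance f c θ D)) hD).trans (hsensS θ)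
  have hH : ∀ θ, edist (toVec (riskHessian hess c θ D)) (toVec (riskHessian hess c θ D')) ≤
      sensH θ := fun θ => (edist_le_l2Sensitivity
        (fun D : Database n d => toVec (riskHessian hess c θ D)) hD).trans (hsensH θ)
  have hcov : ∀ p, HolderDominated (ENNReal.ofReal (Real.exp (t * φ₃)) * 1) q
      (covarianceStage mode f sensS c φ₁ φ₃ ci D p)
      (covarianceStage mode f sensS c φ₁ φ₃ ci D' p) := fun p =>
    (privSPDMat_dominated h (hS p.1) hφ₃ c).bind hq
      (hlaw.comp measurable_prodMk_left) (hlaw.comp measurable_prodMk_left)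
      fun S => HolderDominated.refl hq _
  have hhes : ∀ θ, HolderDominated (ENNReal.ofReal (Real.exp (t * φ₂)) *
      (ENNReal.ofReal (Real.exp (t * φ₃)) * 1)) q
      (hessianStage mode f hess sensH sensS c φ₁ φ₂ φ₃ ci D θ)
      (hessianStage mode f hess sensH sensS c φ₁ φ₂ φ₃ ci D' θ) := fun θ =>
    (privSPDMat_dominated h (hH θ) hφ₂ c).bind hq
      ((measurable_covarianceStage mode hφ₁ hφ₃ hsensS_meas hci D).comp measurable_prodMk_left)
      ((measurable_covarianceStage mode hφ₁ hφ₃ hsensS_meas hci D').comp measurable_prodMk_left)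
      fun H => hcov (θ, H)
  have hall := (outputPerturb_dominated h hn hf_convex hf_diff hf_deriv hc hφ₁ hD).bind hq
    (measurable_hessianStage mode hφ₁ hφ₂ hφ₃ hhess hsensH_meas hsensS_meas hci D)
    (measurable_hessianStage mode hφ₁ hφ₂ hφ₃ hhess hsensH_meas hsensS_meas hci D') hhes
  rw [ciOutput_eq_bind, ciOutput_eq_bind]
  refine hall.mono (le_of_eq ?_)
  rw [mul_one, ← ENNReal.ofReal_mul (Real.exp_pos _).le, ← Real.exp_add,
    ← ENNReal.ofReal_mul (Real.exp_pos _).le, ← Real.exp_add]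
  ring_nf

end Algorithm

end DPCI

end

/-! ### The privacy theorem -/

theorem mainTheorem2 {n d : ℕ} (hn : 0 < n)
    (f : ℝ → ℝ) (hf_convex : ConvexOn ℝ Set.univ f) (hf_diff : Differentiable ℝ f)
    (hf_deriv : ∀ z, |deriv f z| ≤ 1)
    (c φ₁ φ₂ φ₃ : ℝ) (hc : 0 < c) (hφ₁ : 0 < φ₁) (hφ₂ : 0 < φ₂) (hφ₃ : 0 < φ₃)
    (hess : DPCI.Record d → EuclideanSpace ℝ (Fin d) → Matrix (Fin d) (Fin d) ℝ)
    (hhess : DPCI.IsLossHessian f hess)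
    (sensH sensS : EuclideanSpace ℝ (Fin d) → ℝ≥0)
    (hsensH_meas : Measurable sensH) (hsensS_meas : Measurable sensS)
    (hsensH : ∀ θ, DPCI.l2Sensitivity
      (fun D : DPCI.Database n d => DPCI.toVec (DPCI.riskHessian hess c θ D)) ≤ sensH θ)
    (hsensS : ∀ θ, DPCI.l2Sensitivity
      (fun D : DPCI.Database n d => DPCI.toVec (DPCI.gradCovariance f c θ D)) ≤ sensS θ)
    (m : ℕ) (α : ℝ) (hα : α ∈ Set.Ioo (0 : ℝ) 1)
    (ci : (Fin m → ℝ) → ℝ × ℝ) (hci : DPCI.IsConfidenceRule α ci) :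
    DPCI.IsDifferentiallyPrivate (φ₁ + φ₂ + φ₃)
        (DPCI.ciOutput (n := n) .pureDP f hess sensH sensS c φ₁ φ₂ φ₃ m ci) ∧
      DPCI.IsZCDP (φ₁ + φ₂ + φ₃)
        (DPCI.ciOutput (n := n) .zCDP f hess sensH sensS c φ₁ φ₂ φ₃ m ci) := by
  have hprob := fun mode => DPCI.isProbabilityMeasure_ciOutput (n := n) (c := c) mode hφ₁ hφ₂ hφ₃
    hhess hsensH_meas hsensS_meas hci.measurable
  refine ⟨⟨hprob _, fun D D' hD V hV => ?_⟩, ⟨hprob _, fun D D' hD a ha => ?_⟩⟩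
  · have h := DPCI.ciOutput_dominated (mode := .pureDP) (t := 1) (q := 1) ⟨rfl, rfl⟩ hn hf_convex
      hf_diff hf_deriv hc hφ₁ hφ₂ hφ₃ hhess hsensH_meas hsensS_meas hsensH hsensS hci.measurable hD
    rw [one_mul] at h
    exact h.apply_le hV
  -- With `t = a - 1` the exponent `q` is conjugate to the order `a`, and the constant `exp ((a - 1)
  -- ρ)` bounds the `a`-th moment of the density by `exp ((a - 1) ρ a)`, that is, the divergence by
  -- `ρ a`.
  · have h := DPCI.ciOutput_dominated (mode := .zCDP) (t := a - 1) (q := a / (a - 1))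
      ⟨sub_pos.2 ha, by rw [sub_add_cancel]⟩ hn hf_convex hf_diff hf_deriv hc hφ₁ hφ₂ hφ₃ hhess
      hsensH_meas hsensS_meas hsensH hsensS hci.measurable hD
    have := hprob .zCDP D
    have := hprob .zCDP D'
    exact h.renyiDiv_le ha
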